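/- Let $K$ be a field and let $0\le k\le n$ and $1\le r\le\lfloor n/2\rfloor$ be integers. Let $A=(a_{ij})$ and $B=(b_{ij})$ be $n\times n$ matrices whose $2n^2$ entries are independent indeterminates. For $N\times N$ matrices $X,Y$ over a commutative ring, let $T(X,Y)=\det M(X,Y)$, where $M(X,Y)$ is the $N^2\times N^2$ matrix consisting of $N\times N$ blocks, the $(i,j)$-th block being $X^{j-1}Y^{i-1}$ $(i,j=1,\dots,N)$. For an $n\times n$ matrix $X$, let $X_k$ be the $\binom nk\times\binom nk$ matrix, in the basis of wedge products of standard basis vectors, of the action of $X$ on the $k$-th exterior power by the Leibniz rule $$X_k(v_1\wedge\dots\wedge v_k)=\sum_{i=1}^k v_1\wedge\dots\wedge Xv_i\wedge\dots\wedge v_k .$$ For $m\ge 1$ put $$\delta_m(\lambda_1,\dots,\lambda_n)=\prod_{(S,T)}\Bigl(\sum_{t\in T}\lambda_t-\sum_{s\in S}\lambda_s\Bigr),$$ where $(S,T)$ runs over the pairs of disjoint $m$-element subsets of $\{1,\dots,n\}$ with $\min S<\min T$. Let $\lambda_1,\dots,\lambda_n$ be the roots of the characteristic polynomial of $A$. For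 $m\ge 2$ the discriminant of order $m$ is $D_m(A)=\delta_m(\lambda_1,\dots,\lambda_n)$; furthermore $D_1(A)=\delta_1(\lambda_1,\dots,\lambda_n)^2$ if the characteristic is not $2$, and $D_1(A)=\delta_1(\lambda_1,\dots,\lambda_n)$ (the square root of $\delta_1(\lambda_1,\dots,\lambda_n)^2$) in characteristic $2$. These expressions are symmetric in the $\lambda_s$, so $D_m(A)$ is a polynomial in the entries of $A$; $D_m(B)$ is defined likewise. Working over $\mathbb Z$, put $$G_k(A)=\prod_{2\le m\le k}D_m(A)^{\binom nk\binom{n-2m}{k-m}},\qquad T_k(A,B)=\frac{T(A_k,B_k)}{G_k(A)\,G_k(B)}.$$ The $k$-th triangulant $T_k(A,B)$ is a polynomial with integer coefficients in the entries of $A$ and $B$; reducing its coefficients, we regard it as an element of $K[a_{ij},b_{ij}: i,j=1,\dots,n]$. Then, in $K[a_{ij},b_{ij}: i,j=1,\dots,n]$, neither of the discriminants $D_r(A)$ and $D_r(B)$ (formed over $K$) divides $T_k(A,B)$. -/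

import Mathlib

namespace Triangulant

open MvPolynomial

/-! ### The first triangulant -/

/-- The block matrix `M(A, B)`, whose `(i, j)` block is `A ^ j * B ^ i`, where the block indices
`i, j` run from `0` to `N - 1` and `N` is the size of `A` and `B`. -/
def blockMatrix {ι R : Type*} [Fintype ι] [DecidableEq ι] [CommRing R] (A B : Matrix ι ι R) :
    Matrix (Fin (Fintype.card ι) × ι) (Fin (Fintype.card ι) × ι) R :=
  Matrix.of fun x y => (A ^ (y.1 : ℕ) * B ^ (x.1 : ℕ)) x.2 y.2

/-- The first triangulant `T(A, B) = det M(A, B)`. -/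
def triangulant {ι R : Type*} [Fintype ι] [DecidableEq ι] [CommRing R] (A B : Matrix ι ι R) : R :=
  (blockMatrix A B).det

/-! ### The action of a matrix on the exterior power by the Leibniz rule -/

section Leibniz

variable {R M : Type*} [CommRing R] [AddCommGroup M] [Module R M]

/-- The alternating map `v ↦ ∑ i, v₁ ∧ ⋯ ∧ f vᵢ ∧ ⋯ ∧ vₖ`. -/
noncomputable def leibnizAlternating (k : ℕ) (f : M →ₗ[R] M) :
    M [⋀^Fin k]→ₗ[R] (⋀[R]^k M) :=
  { ∑ i : Fin k, (exteriorPower.ιMulti R k (M := M)).toMultilinearMap.compLinearMap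
      (fun j => if j = i then f else LinearMap.id) with
    map_eq_zero_of_eq' := by
      intro v a b hv hab
      have key : ∀ i : Fin k, (fun j => (if j = i then f else LinearMap.id) (v j))
          = Function.update v i (f (v i)) := by
        intro i
        funext j
        by_cases h : j = i
        · subst h; simp
        · simp [h]
      have hsum : ∑ i : Fin k, exteriorPower.ιMulti R k (Function.update v i (f (v i))) = 0 := by
        rw [Finset.sum_eq_add a b hab]
        · have h : Function.update v b (f (v b))
              = Function.update v a (f (v a)) ∘ Equiv.swap a b := by
            funext j
            by_cases h1 : j = a
            · subst h1; simp [hab, hab.symm, hv]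
            · by_cases h2 : j = b
              · subst h2; simp [hv]
              · simp [h1, h2, Equiv.swap_apply_of_ne_of_ne h1 h2]
          rw [h, AlternatingMap.map_swap _ _ hab, add_neg_cancel]
        · intro c _ hc
          refine AlternatingMap.map_eq_zero_of_eq _ _ (i := a) (j := b) ?_ hab
          rw [Function.update_of_ne hc.1.symm, Function.update_of_ne hc.2.symm, hv]
        · simp
        · simp
      simpa [key] using hsum }

/-- The linear endomorphism of `⋀ᵏ M` induced by `f` via the Leibniz rule, that is,
`v₁ ∧ ⋯ ∧ vₖ ↦ ∑ i, v₁ ∧ ⋯ ∧ f vᵢ ∧ ⋯ ∧ vₖ`. -/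
noncomputable def leibnizMap (k : ℕ) (f : M →ₗ[R] M) : (⋀[R]^k M) →ₗ[R] (⋀[R]^k M) :=
  exteriorPower.alternatingMapLinearEquiv (leibnizAlternating k f)

theorem leibnizMap_apply (k : ℕ) (f : M →ₗ[R] M) (v : Fin k → M) :
    leibnizMap k f (exteriorPower.ιMulti R k v)
      = ∑ i : Fin k, exteriorPower.ιMulti R k (Function.update v i (f (v i))) := by
  have key : ∀ i : Fin k, (fun j => (if j = i then f else LinearMap.id) (v j))
      = Function.update v i (f (v i)) := by
    intro i
    funext j
    by_cases h : j = i
    · subst h; simp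
    · simp [h]
  rw [leibnizMap, exteriorPower.alternatingMapLinearEquiv_apply_ιMulti]
  change (∑ i : Fin k, (exteriorPower.ιMulti R k (M := M)).toMultilinearMap.compLinearMap
      (fun j => if j = i then f else LinearMap.id)) v = _
  simp [key]

end Leibniz

/-- The matrix `A_k`, of size `n.choose k`, of the Leibniz action of `A` on `⋀ᵏ Rⁿ`, with respect
to the basis consisting of the wedge products of `k` standard basis vectors, indexed by the
`k`-element subsets of `Fin n`. -/
noncomputable def powMatrix {R : Type*} [CommRing R] {n : ℕ} (k : ℕ)
    (A : Matrix (Fin n) (Fin n) R) :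
    Matrix (Set.powersetCard (Fin n) k) (Set.powersetCard (Fin n) k) R :=
  LinearMap.toMatrix ((Pi.basisFun R (Fin n)).exteriorPower k)
    ((Pi.basisFun R (Fin n)).exteriorPower k) (leibnizMap k (Matrix.toLin' A))

/-! ### Discriminants of higher order -/

/-- Pairs `(S, T)` of disjoint `r`-element subsets with `min S < min T`. -/
def pairs (n r : ℕ) : Finset (Finset (Fin n) × Finset (Fin n)) :=
  {p ∈ (Finset.univ.powersetCard r) ×ˢ (Finset.univ.powersetCard r) |
    Disjoint p.1 p.2 ∧ p.1.min < p.2.min}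

/-- The polynomial `δ_r(λ₁, …, λₙ) = ∏ (λ_T - λ_S)`, where `λ_S = ∑ s ∈ S, λ_s`. -/
noncomputable def delta (R : Type*) [CommRing R] (n r : ℕ) : MvPolynomial (Fin n) R :=
  ∏ p ∈ pairs n r, (∑ t ∈ p.2, X t - ∑ s ∈ p.1, X s)

theorem mem_pairs {n r : ℕ} {p : Finset (Fin n) × Finset (Fin n)} :
    p ∈ pairs n r ↔ p.1.card = r ∧ p.2.card = r ∧ Disjoint p.1 p.2 ∧ p.1.min < p.2.min := by
  simp [pairs, Finset.mem_powersetCard, and_assoc]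

theorem prod_eq_or_neg {α S : Type*} [CommRing S] (s : Finset α) (f g : α → S)
    (h : ∀ a ∈ s, f a = g a ∨ f a = -g a) :
    ∏ a ∈ s, f a = ∏ a ∈ s, g a ∨ ∏ a ∈ s, f a = -∏ a ∈ s, g a := by
  classical
  induction s using Finset.induction_on with
  | empty => simp
  | insert a s ha ih =>
    rw [Finset.prod_insert ha, Finset.prod_insert ha]
    rcases ih fun b hb => h b (Finset.mem_insert_of_mem hb) with h1 | h1 <;>
      rcases h a (Finset.mem_insert_self a s) with h2 | h2 <;> simp [h1, h2]

/-- Permuting the variables changes `δ_r` at most by a sign. -/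
theorem rename_delta (R : Type*) [CommRing R] (n r : ℕ) (σ : Equiv.Perm (Fin n)) :
    rename σ (delta R n r) = delta R n r ∨ rename σ (delta R n r) = -delta R n r := by
  classical
  rcases Nat.eq_zero_or_pos r with rfl | hr
  · have : pairs n 0 = ∅ := by
      ext p
      simp only [mem_pairs, Finset.card_eq_zero, Finset.notMem_empty, iff_false]
      rintro ⟨h1, h2, -, h⟩
      simp [h1, h2] at h
    simp [delta, this]
  set e : Finset (Fin n) → Finset (Fin n) := fun S => S.map σ.toEmbedding with he
  have einj : Function.Injective e := Finset.map_injective _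
  set N : Finset (Fin n) × Finset (Fin n) → Finset (Fin n) × Finset (Fin n) :=
    fun p => if (e p.1).min < (e p.2).min then (e p.1, e p.2) else (e p.2, e p.1) with hN
  set g : Finset (Fin n) × Finset (Fin n) → MvPolynomial (Fin n) R :=
    fun p => ∑ t ∈ p.2, X t - ∑ s ∈ p.1, X s with hg
  have hmaps : ∀ p ∈ pairs n r, N p ∈ pairs n r := by
    intro p hp
    obtain ⟨h1, h2, h3, h4⟩ := mem_pairs.1 hp
    have hd : Disjoint (e p.1) (e p.2) := (Finset.disjoint_map _).2 h3
    simp only [hN]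
    split_ifs with h
    · exact mem_pairs.2 ⟨by simp [he, h1], by simp [he, h2], hd, h⟩
    · refine mem_pairs.2 ⟨by simp [he, h2], by simp [he, h1], hd.symm, ?_⟩
      refine lt_of_le_of_ne (not_lt.1 h) fun heq => ?_
      have hne : (e p.1).Nonempty := by
        rw [← Finset.card_pos]; simp [he, h1, hr]
      obtain ⟨m, hm⟩ := Finset.min_of_nonempty hne
      have hm2 : (e p.2).min = m := heq.trans hm
      exact Finset.disjoint_left.1 hd (Finset.mem_of_min hm) (Finset.mem_of_min hm2)
  have hinj : Set.InjOn N (pairs n r : Set _) := by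
    intro p hp q hq hpq
    obtain ⟨-, -, -, h4⟩ := mem_pairs.1 (Finset.mem_coe.1 hp)
    obtain ⟨-, -, -, h4'⟩ := mem_pairs.1 (Finset.mem_coe.1 hq)
    simp only [hN] at hpq
    split_ifs at hpq <;> rw [Prod.mk.injEq, einj.eq_iff, einj.eq_iff] at hpq
    · exact Prod.ext hpq.1 hpq.2
    · rw [hpq.1, hpq.2] at h4
      exact absurd h4 h4'.asymm
    · rw [hpq.1, hpq.2] at h4
      exact absurd h4 h4'.asymm
    · exact Prod.ext hpq.2 hpq.1
  have hre : ∏ p ∈ pairs n r, g (N p) = delta R n r :=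
    Finset.prod_nbij N hmaps hinj
      (Finset.surjOn_of_injOn_of_card_le N hmaps hinj le_rfl) fun _ _ => rfl
  have hren : rename σ (delta R n r) = ∏ p ∈ pairs n r, g (e p.1, e p.2) := by
    simp [delta, hg, he, map_prod]
  rw [hren, ← hre]
  refine prod_eq_or_neg _ _ _ fun p _ => ?_
  simp only [hN]
  split_ifs with h
  · exact Or.inl rfl
  · right; simp [hg]

theorem map_delta (R : Type*) [CommRing R] (n r : ℕ) :
    map (Int.castRingHom R) (delta ℤ n r) = delta R n r := by
  simp [delta, map_prod]

theorem rename_swap_delta_int (n r : ℕ) (hr : 2 ≤ r) (i j : Fin n) :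
    rename (Equiv.swap i j) (delta ℤ n r) = delta ℤ n r := by
  classical
  rcases rename_delta ℤ n r (Equiv.swap i j) with h | h
  · exact h
  exfalso
  set f : Fin n → Fin n := fun s => if s = j then i else s with hf
  have hcomp : f ∘ (Equiv.swap i j) = f := by
    funext s
    simp only [hf, Function.comp_apply]
    by_cases h1 : s = i
    · subst h1; simp
    · by_cases h2 : s = j
      · subst h2; simp
      · simp [Equiv.swap_apply_of_ne_of_ne h1 h2]
  have h0 : rename f (delta ℤ n r) = 0 := by
    have h2 := congrArg (rename f) h
    rw [rename_rename, hcomp, map_neg] at h2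
    exact self_eq_neg.1 h2
  simp only [delta, map_prod, Finset.prod_eq_zero_iff] at h0
  obtain ⟨p, hp, hp0⟩ := h0
  obtain ⟨h1, h2, h3, -⟩ := mem_pairs.1 hp
  obtain ⟨l, hl, hlij⟩ : ∃ l ∈ p.1 ∪ p.2, l ∉ ({i, j} : Finset (Fin n)) := by
    apply Finset.exists_mem_notMem_of_card_lt_card
    rw [Finset.card_union_of_disjoint h3, h1, h2]
    exact lt_of_le_of_lt Finset.card_le_two (by omega)
  have hli : l ≠ i := fun h => hlij (by simp [h])
  have hlj : l ≠ j := fun h => hlij (by simp [h])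
  have hfl : ∀ s, (if f s = l then (1 : ℤ) else 0) = if s = l then 1 else 0 := by
    intro s
    simp only [hf]
    by_cases hs : s = j
    · subst hs; simp [hli.symm, hlj.symm]
    · simp [hs]
  have hev := congrArg (eval fun s => if s = l then (1 : ℤ) else 0) hp0
  simp only [map_sub, map_sum, rename_X, eval_X, hfl, Finset.sum_ite_eq', map_zero] at hev
  rcases Finset.mem_union.1 hl with hl | hl
  · simp [hl, Finset.disjoint_left.1 h3 hl] at hev
  · simp [hl, Finset.disjoint_right.1 h3 hl] at hev

/-- For `r ≥ 2`, the polynomial `δ_r` is symmetric. -/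
theorem delta_isSymmetric (R : Type*) [CommRing R] (n r : ℕ) (hr : 2 ≤ r) :
    (delta R n r).IsSymmetric := by
  intro σ
  rw [← map_delta, ← map_rename]
  congr 1
  induction σ using Equiv.Perm.swap_induction_on with
  | one => simp
  | swap_mul f x y _ ih =>
    rw [Equiv.Perm.coe_mul, ← rename_rename, ih, rename_swap_delta_int n r hr]

theorem delta_isSymmetric_of_two_eq_zero (R : Type*) [CommRing R] (n r : ℕ) (h2 : ringChar R = 2) :
    (delta R n r).IsSymmetric := by
  intro σ
  rcases rename_delta R n r σ with h | h
  · exact h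
  · have h20 : (2 : R) = 0 := by
      have := ringChar.Nat.cast_ringChar (R := R)
      rwa [h2, Nat.cast_ofNat] at this
    have : (2 : MvPolynomial (Fin n) R) = 0 := by
      rw [← map_ofNat (C (σ := Fin n) (R := R)) 2, h20, map_zero]
    rw [h]
    linear_combination -(delta R n r) * this

theorem delta_sq_isSymmetric (R : Type*) [CommRing R] (n r : ℕ) :
    (delta R n r ^ 2).IsSymmetric := by
  intro σ
  rw [map_pow]
  rcases rename_delta R n r σ with h | h <;> rw [h]
  ring

/-- For a symmetric polynomial `p` in `n` variables, the value `p(λ₁, …, λₙ)` at the eigenvalues of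
a generic `n × n` matrix, as a polynomial in the entries of that matrix: `p` is written (uniquely)
as a polynomial in the elementary symmetric polynomials `e₁, …, eₙ`, and `e_m` is replaced by
`(-1) ^ m` times the coefficient of `x ^ (n - m)` in the characteristic polynomial. -/
noncomputable def eigenvaluePoly {R : Type*} [CommRing R] {n : ℕ} (p : MvPolynomial (Fin n) R)
    (hp : p.IsSymmetric) : MvPolynomial (Fin n × Fin n) R :=
  aeval (fun i : Fin n => (-1) ^ ((i : ℕ) + 1) *
      (Matrix.charpoly.univ R (Fin n)).coeff (n - ((i : ℕ) + 1)))
    ((esymmAlgEquiv (Fin n) R (Fintype.card_fin n)).symm ⟨p, hp⟩)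

/-- The discriminant `D_r` of order `r ≥ 1`, as a polynomial in the entries of an `n × n` matrix,
with coefficients in `R`. In terms of the eigenvalues, `D_1 = δ_1 ^ 2` if the characteristic of `R`
is not `2`; `D_1 = δ_1`, the square root of `δ_1 ^ 2`, in characteristic `2`;
and `D_r = δ_r` if `r ≥ 2`. (The value for `r = 0` is irrelevant.) -/
noncomputable def disc (R : Type*) [CommRing R] (n r : ℕ) : MvPolynomial (Fin n × Fin n) R :=
  if hr : 2 ≤ r then eigenvaluePoly (delta R n r) (delta_isSymmetric R n r hr)
  else if h2 : ringChar R = 2 then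
    eigenvaluePoly (delta R n r) (delta_isSymmetric_of_two_eq_zero R n r h2)
  else eigenvaluePoly (delta R n r ^ 2) (delta_sq_isSymmetric R n r)

/-- The polynomial `G_k = ∏_{2 ≤ r ≤ k} D_r ^ (n.choose k * (n - 2r).choose (k - r))`, with integer
coefficients. (For `2 * r > n`, we have `D_r = 1`, so the exponent does not matter.) -/
noncomputable def gPoly (n k : ℕ) : MvPolynomial (Fin n × Fin n) ℤ :=
  ∏ r ∈ Finset.Icc 2 k, disc ℤ n r ^ (n.choose k * (n - 2 * r).choose (k - r))

/-! ### Triangulants of higher order -/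

/-- The generic matrix `A = (a_ij)`; the variable `a_ij` is `X (Sum.inl (i, j))`. -/
noncomputable def genericA (n : ℕ) :
    Matrix (Fin n) (Fin n) (MvPolynomial ((Fin n × Fin n) ⊕ (Fin n × Fin n)) ℤ) :=
  Matrix.of fun i j => X (Sum.inl (i, j))

/-- The generic matrix `B = (b_ij)`; the variable `b_ij` is `X (Sum.inr (i, j))`. -/
noncomputable def genericB (n : ℕ) :
    Matrix (Fin n) (Fin n) (MvPolynomial ((Fin n × Fin n) ⊕ (Fin n × Fin n)) ℤ) :=
  Matrix.of fun i j => X (Sum.inr (i, j))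

open Classical in
/-- The quotient `a / b` in a commutative ring, for `b` a divisor of `a`; otherwise `0`. -/
noncomputable def exactQuotient {R : Type*} [CommRing R] (a b : R) : R :=
  if h : b ∣ a then h.choose else 0

/-- The `k`-th triangulant `T_k(A, B) = T(A_k, B_k) / (G_k(A) * G_k(B))`, a polynomial with integer
coefficients in the entries of two generic `n × n` matrices `A` and `B`. -/
noncomputable def kTriangulant (n k : ℕ) :
    MvPolynomial ((Fin n × Fin n) ⊕ (Fin n × Fin n)) ℤ :=
  exactQuotient (triangulant (powMatrix k (genericA n)) (powMatrix k (genericB n)))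
    (rename Sum.inl (gPoly n k) * rename Sum.inr (gPoly n k))

end Triangulant

/-! ### The block determinant -/

namespace Triangulant

open Matrix

section Block

variable {ι R : Type*} [Fintype ι] [DecidableEq ι] [CommRing R]

/-! Everything rests on one formula. Let `W` diagonalize `X` from the left with eigenvalues `l`, and
`Q` diagonalize `Y` from the right with eigenvalues `m`. Multiplying the blocks of `M(X, Y)` by `W`
and `Q` gives the entries `l_a ^ j * (W * Q) a b * m_b ^ i`, and the determinant of this matrix is,
up to sign, `V(l) ^ N * V(m) ^ N * ∏ (W * Q) a b`, with Vandermonde determinants `V`. For `A_k` and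
`B_k` the eigenvectors are given by compound matrices and the eigenvalues are the subset sums `l_S`.
Up to sign, their Vandermonde determinant is the product of the `δ_m(l) ^ (n - 2m).choose (k - m)`
(`associated_det_vandermonde_sum`), whose part with `m ≥ 2` accounts for `G_k`. The result is
`triangulant_powMatrix_of_intertwine`.

Since `exactQuotient` is `0` when there is no divisibility, `G_k(A) * G_k(B)` must first be shown to
divide `T(A_k, B_k)` over `ℤ` (`gPoly_dvd_triangulant`). Eigenvalues are adjoined in an integral
closure. The determinants of suitable eigenvector matrices divide `clearingFactor`, a polynomial in
the entries coprime to `G_k(A) * G_k(B)`, and divisibility descends because the polynomial ring is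
integrally closed.

For non-divisibility, a point is sought where `D_r(A)` vanishes and `T_k` does not. Take `A =
diag(l) + E_ij` and `B` with a generic eigenvector matrix `H`. The term `E_ij` keeps `A` useful when
`l_i = l_j`, which is the case `r = 1`. With generic `l` over `ℤ` the formula applies, and all
powers of `l_j - l_i` and all `δ_m(l)`, `m ≥ 2`, cancel (`associated_jordanValue`). The remaining
expression `jordanValue` is polynomial, so it can be reduced to `K` and specialized to `l` with
`δ_r(l) = 0` and no coincidence among the `l_x` except possibly `l_i = l_j`. All its factors are
then nonzero. Transposition exchanges the roles of `A` and `B`. -/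

theorem det_blocks_diagonal (e : ι ≃ Fin (Fintype.card ι)) (l m : ι → R) (C : Matrix ι ι R) :
    Associated
      (Matrix.of fun x y : Fin (Fintype.card ι) × ι =>
        l x.2 ^ (y.1 : ℕ) * C x.2 y.2 * m y.2 ^ (x.1 : ℕ)).det
      ((vandermonde (l ∘ e.symm)).det ^ Fintype.card ι *
        (vandermonde (m ∘ e.symm)).det ^ Fintype.card ι * ∏ a, ∏ b, C a b) := by
  set σ : Equiv.Perm (Fin (Fintype.card ι) × ι) :=
    (Equiv.prodComm _ _).trans (e.prodCongr e.symm) with hσ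
  -- The powers of `m` and of `l` are separated by a diagonal matrix carrying the entries of `C`.
  -- The intermediate index `(d, c)` stands for the pair `(c, e.symm d)`, and `σ` exchanges its two
  -- components, at the cost of a sign.
  have hfac : (Matrix.of fun x y : Fin (Fintype.card ι) × ι =>
        l x.2 ^ (y.1 : ℕ) * C x.2 y.2 * m y.2 ^ (x.1 : ℕ)) =
      (kroneckerMap (· * ·) (vandermonde (m ∘ e.symm))ᵀ (1 : Matrix ι ι R)) *
        diagonal (fun z : Fin (Fintype.card ι) × ι => C z.2 (e.symm z.1)) *
        (kroneckerMap (· * ·) (vandermonde (l ∘ e.symm)) (1 : Matrix ι ι R)).submatrix σ id := by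
    ext ⟨i, a⟩ ⟨j, b⟩
    rw [Matrix.mul_apply, Fintype.sum_prod_type, Finset.sum_eq_single (e b),
      Finset.sum_eq_single a]
    · simp [hσ, mul_diagonal, kroneckerMap_apply, vandermonde_apply]
      ring
    · intro c _ hc
      simp [mul_diagonal, kroneckerMap_apply, Matrix.one_apply, hc.symm]
    · simp
    · intro d _ hd
      refine Finset.sum_eq_zero fun c _ => ?_
      have : e.symm d ≠ b := fun h => hd (by simp [← h])
      simp [hσ, mul_diagonal, kroneckerMap_apply, Matrix.one_apply, this]
    · simp
  have hdiag : ∏ z : Fin (Fintype.card ι) × ι, C z.2 (e.symm z.1) = ∏ a, ∏ b, C a b := by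
    rw [Fintype.prod_prod_type_right]
    refine Finset.prod_congr rfl fun a _ => ?_
    exact e.symm.prod_comp (fun b => C a b)
  rw [hfac, det_mul, det_mul, det_permute, det_diagonal, hdiag, det_kronecker, det_kronecker]
  simp only [det_transpose, Fintype.card_fin, det_one, one_pow, mul_one]
  refine ⟨((Equiv.Perm.sign σ).map (Int.castRingHom R).toMonoidHom), ?_⟩
  have hs : (((Equiv.Perm.sign σ : ℤ) : R)) * ((Equiv.Perm.sign σ : ℤ) : R) = 1 := by
    rw [← Int.cast_mul, ← Units.val_mul, Int.units_mul_self]; simp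
  have hc : (((Equiv.Perm.sign σ).map (Int.castRingHom R).toMonoidHom : Rˣ) : R)
      = ((Equiv.Perm.sign σ : ℤ) : R) := by simp
  rw [hc]
  linear_combination (vandermonde (l ∘ e.symm)).det ^ Fintype.card ι *
    (vandermonde (m ∘ e.symm)).det ^ Fintype.card ι * (∏ a, ∏ b, C a b) * hs

/-- The block-diagonal matrices with all blocks `W`, respectively `Q`, act on each block separately,
and their determinants are powers of `W.det` and `Q.det`. -/
theorem kronecker_one_mul_blockMatrix_mul (X Y W Q : Matrix ι ι R) :
    (kroneckerMap (· * ·) (1 : Matrix (Fin (Fintype.card ι)) (Fin (Fintype.card ι)) R) W) *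
      blockMatrix X Y *
      (kroneckerMap (· * ·) (1 : Matrix (Fin (Fintype.card ι)) (Fin (Fintype.card ι)) R) Q) =
    Matrix.of fun x y => (W * (X ^ (y.1 : ℕ) * Y ^ (x.1 : ℕ)) * Q) x.2 y.2 := by
  ext ⟨i, a⟩ ⟨j, b⟩
  rw [Matrix.mul_apply, Fintype.sum_prod_type, Finset.sum_eq_single j]
  · rw [of_apply, Matrix.mul_apply]
    refine Finset.sum_congr rfl fun d _ => ?_
    rw [kroneckerMap_apply, one_apply_eq, one_mul]
    congr 1
    rw [Matrix.mul_apply, Fintype.sum_prod_type, Finset.sum_eq_single i, Matrix.mul_apply]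
    · simp [blockMatrix, kroneckerMap_apply]
    · intro c _ hc
      simp [kroneckerMap_apply, hc.symm]
    · simp
  · intro c _ hc
    simp [kroneckerMap_apply, hc]
  · simp

/-- The first triangulant of two matrices diagonalized by `W` and `Q`. -/
theorem triangulant_of_intertwine (e : ι ≃ Fin (Fintype.card ι)) (l m : ι → R)
    {X Y W Q : Matrix ι ι R} (hW : W * X = diagonal l * W) (hQ : Y * Q = Q * diagonal m) :
    Associated (W.det ^ Fintype.card ι * triangulant X Y * Q.det ^ Fintype.card ι)
      ((vandermonde (l ∘ e.symm)).det ^ Fintype.card ι *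
        (vandermonde (m ∘ e.symm)).det ^ Fintype.card ι * ∏ a, ∏ b, (W * Q) a b) := by
  refine Associated.trans (.of_eq ?_) (det_blocks_diagonal e l m (W * Q))
  have h1 : ∀ j : ℕ, W * X ^ j = diagonal l ^ j * W := by
    intro j
    exact ((show SemiconjBy W X (diagonal l) from hW).pow_right j)
  have h2 : ∀ j : ℕ, Y ^ j * Q = Q * diagonal m ^ j := by
    intro j
    exact ((show SemiconjBy Q (diagonal m) Y from hQ.symm).pow_right j).symm
  have h3 := congrArg det (kronecker_one_mul_blockMatrix_mul X Y W Q)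
  rw [det_mul, det_mul, det_kronecker, det_kronecker] at h3
  simp only [det_one, one_pow, one_mul, Fintype.card_fin] at h3
  rw [triangulant, h3]
  congr 1
  ext ⟨i, a⟩ ⟨j, b⟩
  simp only [of_apply]
  have : W * (X ^ (j : ℕ) * Y ^ (i : ℕ)) * Q
      = diagonal l ^ (j : ℕ) * (W * Q) * diagonal m ^ (i : ℕ) := by
    rw [← Matrix.mul_assoc W, h1, Matrix.mul_assoc, Matrix.mul_assoc, h2]
    simp only [Matrix.mul_assoc]
  rw [this, diagonal_pow, diagonal_pow, mul_diagonal, diagonal_mul]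
  simp

theorem map_triangulant {S : Type*} [CommRing S] (f : R →+* S) (X Y : Matrix ι ι R) :
    f (triangulant X Y) = triangulant (X.map f) (Y.map f) := by
  rw [triangulant, triangulant, RingHom.map_det]
  congr 1
  ext x y
  simp only [blockMatrix, RingHom.mapMatrix_apply, map_apply, of_apply]
  change f.mapMatrix (X ^ (y.1 : ℕ) * Y ^ (x.1 : ℕ)) x.2 y.2 =
    (f.mapMatrix X ^ (y.1 : ℕ) * f.mapMatrix Y ^ (x.1 : ℕ)) x.2 y.2
  rw [map_mul, map_pow, map_pow]

end Block

end Triangulant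

/-! ### Compound matrices -/

namespace Triangulant

open Matrix

section Compound

variable {R : Type*} [CommRing R] {n : ℕ}

/-- The increasing enumeration of a `k`-element subset. -/
def enum {k : ℕ} (s : Set.powersetCard (Fin n) k) : Fin k → Fin n :=
  Set.powersetCard.ofFinEmbEquiv.symm s

theorem enum_injective {k : ℕ} (s : Set.powersetCard (Fin n) k) : Function.Injective (enum s) :=
  (Set.powersetCard.ofFinEmbEquiv.symm s).injective

theorem mem_range_enum {k : ℕ} (s : Set.powersetCard (Fin n) k) (i : Fin n) :
    i ∈ Set.range (enum s) ↔ i ∈ (s : Finset (Fin n)) :=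
  Set.powersetCard.mem_range_ofFinEmbEquiv_symm_iff_mem s i

theorem enum_mem {k : ℕ} (s : Set.powersetCard (Fin n) k) (a : Fin k) :
    enum s a ∈ (s : Finset (Fin n)) :=
  (mem_range_enum s _).1 ⟨a, rfl⟩

theorem image_enum {k : ℕ} (s : Set.powersetCard (Fin n) k) :
    Finset.univ.image (enum s) = (s : Finset (Fin n)) := by
  ext i
  rw [← mem_range_enum]
  simp

theorem sum_enum {M : Type*} [AddCommMonoid M] {k : ℕ} (s : Set.powersetCard (Fin n) k)
    (f : Fin n → M) : ∑ a, f (enum s a) = ∑ i ∈ (s : Finset (Fin n)), f i := by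
  rw [← image_enum s, Finset.sum_image fun a _ b _ h => enum_injective s h]

theorem basisFun_exteriorPower {k : ℕ} (s : Set.powersetCard (Fin n) k) :
    (Pi.basisFun R (Fin n)).exteriorPower k s =
      exteriorPower.ιMulti R k (fun a => (Pi.single (enum s a) 1 : Fin n → R)) := by
  rw [exteriorPower.basis_apply, exteriorPower.ιMulti_family]
  congr 1
  funext a
  simp [enum]

theorem repr_ιMulti {k : ℕ} (v : Fin k → Fin n → R) (s : Set.powersetCard (Fin n) k) :
    ((Pi.basisFun R (Fin n)).exteriorPower k).repr (exteriorPower.ιMulti R k v) s =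
      (Matrix.of fun a b => v a (enum s b)).det := by
  rw [exteriorPower.basis_repr_apply, exteriorPower.ιMultiDual_apply_ιMulti]
  simp [enum]

/-- The `k`-th compound matrix: the matrix of the `k`-th exterior power of `P`. -/
noncomputable def compound (k : ℕ) (P : Matrix (Fin n) (Fin n) R) :
    Matrix (Set.powersetCard (Fin n) k) (Set.powersetCard (Fin n) k) R :=
  LinearMap.toMatrix ((Pi.basisFun R (Fin n)).exteriorPower k)
    ((Pi.basisFun R (Fin n)).exteriorPower k) (exteriorPower.map k (Matrix.toLin' P))

theorem compound_apply (k : ℕ) (P : Matrix (Fin n) (Fin n) R)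
    (s t : Set.powersetCard (Fin n) k) :
    compound k P s t = (P.submatrix (enum s) (enum t)).det := by
  rw [compound, LinearMap.toMatrix_apply, basisFun_exteriorPower,
    exteriorPower.map_apply_ιMulti, repr_ιMulti, ← det_transpose]
  congr 1
  ext a b
  simp

theorem compound_transpose (k : ℕ) (P : Matrix (Fin n) (Fin n) R) :
    compound k Pᵀ = (compound k P)ᵀ := by
  ext s t
  rw [transpose_apply, compound_apply, compound_apply, ← det_transpose]
  rfl

theorem compound_mul (k : ℕ) (P Q : Matrix (Fin n) (Fin n) R) :
    compound k (P * Q) = compound k P * compound k Q := by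
  rw [compound, compound, compound, ← LinearMap.toMatrix_comp, Matrix.toLin'_mul,
    ← exteriorPower.map_comp]

theorem compound_one (k : ℕ) : compound k (1 : Matrix (Fin n) (Fin n) R) = 1 := by
  rw [compound, Matrix.toLin'_one, exteriorPower.map_id, LinearMap.toMatrix_id]

theorem compound_smul (k : ℕ) (c : R) (P : Matrix (Fin n) (Fin n) R) :
    compound k (c • P) = c ^ k • compound k P := by
  ext s t
  rw [Matrix.smul_apply, compound_apply, compound_apply,
    show (c • P).submatrix (enum s) (enum t) = c • P.submatrix (enum s) (enum t) from rfl,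
    det_smul, Fintype.card_fin, smul_eq_mul]

theorem compound_diagonal (k : ℕ) (d : Fin n → R) :
    compound k (diagonal d) = diagonal fun s : Set.powersetCard (Fin n) k => ∏ i ∈ (s : Finset (Fin n)), d i := by
  ext s t
  rw [compound_apply]
  by_cases hst : s = t
  · subst hst
    rw [submatrix_diagonal _ _ (enum_injective s), det_diagonal, diagonal_apply_eq,
      ← image_enum s, Finset.prod_image fun a _ b _ h => enum_injective s h]
    rfl
  · rw [diagonal_apply_ne _ hst]
    obtain ⟨i, his, hit⟩ := (Set.powersetCard.exists_mem_notMem_iff_ne s t).1 hst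
    obtain ⟨a, rfl⟩ := (mem_range_enum s i).2 his
    refine det_eq_zero_of_row_eq_zero a fun b => ?_
    rw [submatrix_apply, diagonal_apply_ne]
    intro h
    exact hit (h ▸ enum_mem t b)

/-- The determinant of a compound matrix divides a power of the determinant. -/
theorem det_compound_dvd (k : ℕ) (P : Matrix (Fin n) (Fin n) R) :
    (compound k P).det ∣ P.det ^ (k * Fintype.card (Set.powersetCard (Fin n) k)) := by
  -- Compounds are multiplicative, so `P * adj(P) = det P • 1` passes to the scalar `det P ^ k` on
  -- the exterior power.
  refine ⟨(compound k P.adjugate).det, ?_⟩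
  rw [← det_mul, ← compound_mul, mul_adjugate, compound_smul, compound_one, det_smul, det_one,
    mul_one, pow_mul]

/-- An explicit formula in the entries makes the compatibility with ring homomorphisms visible. -/
theorem powMatrix_apply (k : ℕ) (X : Matrix (Fin n) (Fin n) R)
    (s t : Set.powersetCard (Fin n) k) :
    powMatrix k X s t = ∑ i : Fin k, (Matrix.of fun a b => if a = i then X (enum s b) (enum t a)
      else if enum t a = enum s b then 1 else 0).det := by
  rw [powMatrix, LinearMap.toMatrix_apply, basisFun_exteriorPower, leibnizMap_apply, map_sum,
    Finset.sum_apply']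
  refine Finset.sum_congr rfl fun i _ => ?_
  rw [repr_ιMulti]
  congr 1
  ext a b
  by_cases h : a = i
  · subst h; simp
  · simp [h, Pi.single_apply, eq_comm (a := enum t a)]

theorem map_powMatrix {S : Type*} [CommRing S] (f : R →+* S) (k : ℕ)
    (X : Matrix (Fin n) (Fin n) R) : (powMatrix k X).map f = powMatrix k (X.map f) := by
  ext s t
  simp only [map_apply, powMatrix_apply, map_sum, RingHom.map_det]
  refine Finset.sum_congr rfl fun i _ => ?_
  congr 1
  ext a b
  simp only [RingHom.mapMatrix_apply, map_apply, of_apply]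
  split_ifs <;> simp

/-- Both sides send `v₁ ∧ ⋯ ∧ vₖ` to the sum over `i` of the wedges of the `W v_a`, with `W X v_i`
in place `i`. Thus compounds of eigenvector matrices diagonalize the Leibniz action. -/
theorem compound_mul_powMatrix (k : ℕ) {W X Y : Matrix (Fin n) (Fin n) R} (h : W * X = Y * W) :
    compound k W * powMatrix k X = powMatrix k Y * compound k W := by
  rw [compound, powMatrix, powMatrix, ← LinearMap.toMatrix_comp, ← LinearMap.toMatrix_comp]
  congr 1
  refine exteriorPower.linearMap_ext ?_
  ext v : 1
  have hv : ∀ x, W *ᵥ (X *ᵥ x) = Y *ᵥ (W *ᵥ x) := fun x => by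
    rw [mulVec_mulVec, mulVec_mulVec, h]
  simp only [LinearMap.compAlternatingMap_apply, LinearMap.comp_apply,
    exteriorPower.map_apply_ιMulti, leibnizMap_apply, map_sum]
  refine Finset.sum_congr rfl fun i _ => ?_
  congr 1
  funext a
  by_cases ha : a = i
  · subst ha; simp [hv]
  · simp [ha]

theorem powMatrix_mul_compound (k : ℕ) {Q X Y : Matrix (Fin n) (Fin n) R} (h : X * Q = Q * Y) :
    powMatrix k X * compound k Q = compound k Q * powMatrix k Y :=
  (compound_mul_powMatrix k h.symm).symm

theorem powMatrix_diagonal (k : ℕ) (d : Fin n → R) :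
    powMatrix k (diagonal d) = diagonal fun s : Set.powersetCard (Fin n) k => ∑ i ∈ (s : Finset (Fin n)), d i := by
  ext s t
  rw [powMatrix, LinearMap.toMatrix_apply, basisFun_exteriorPower, leibnizMap_apply]
  have : ∀ i : Fin k, Function.update (fun a => (Pi.single (enum t a) 1 : Fin n → R)) i
      (toLin' (diagonal d) (Pi.single (enum t i) 1)) = Function.update
        (fun a => (Pi.single (enum t a) 1 : Fin n → R)) i
        (d (enum t i) • (Pi.single (enum t i) 1 : Fin n → R)) := by
    intro i
    congr 1
    ext j
    simp [Pi.single_apply]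
  simp only [this, AlternatingMap.map_update_smul, Function.update_eq_self]
  rw [← Finset.sum_smul, ← basisFun_exteriorPower, map_smul, Module.Basis.repr_self,
    sum_enum t, Finsupp.smul_apply, Finsupp.single_apply,
    diagonal_apply]
  by_cases h : s = t
  · simp [h]
  · simp [h, Ne.symm h]

end Compound

end Triangulant

/-! ### The Vandermonde determinant of the subset sums -/

namespace Triangulant

open Matrix

section Vandermonde

variable {R : Type*} [CommRing R]

theorem associated_sub_comm (x y : R) : Associated (x - y) (y - x) :=
  ⟨-1, by simp⟩

/-- Two orientations of the pairs of distinct elements give associated products. -/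
theorem associated_prod_orientation {ι : Type*} [Fintype ι] [DecidableEq ι] (r r' : ι → ι → Prop)
    [DecidableRel r] [DecidableRel r'] (hr : ∀ a b, r a b → ¬ r b a)
    (hr' : ∀ a b, r' a b → ¬ r' b a) (h : ∀ a b, a ≠ b → r a b ∨ r b a)
    (h' : ∀ a b, a ≠ b → r' a b ∨ r' b a) (f : ι × ι → R)
    (hf : ∀ p, Associated (f p) (f p.swap)) :
    Associated (∏ p with r p.1 p.2, f p) (∏ p with r' p.1 p.2, f p) := by
  have hne : ∀ a b, r a b → a ≠ b := fun a b hab e => hr a b hab (by subst e; exact hab)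
  have hne' : ∀ a b, r' a b → a ≠ b := fun a b hab e => hr' a b hab (by subst e; exact hab)
  set N : ι × ι → ι × ι := fun p => if r' p.1 p.2 then p else p.swap with hN
  have key : ∏ p with r p.1 p.2, f (N p) = ∏ p with r' p.1 p.2, f p := by
    refine Finset.prod_bij' (fun p _ => N p) (fun p _ => if r p.1 p.2 then p else p.swap)
      ?_ ?_ ?_ ?_ (fun _ _ => rfl)
    · rintro ⟨a, b⟩ hp
      have := h' a b (hne a b (by simpa using hp))
      simp only [hN]
      split_ifs with h1 <;> simp_all
    · rintro ⟨a, b⟩ hp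
      have := h a b (hne' a b (by simpa using hp))
      split_ifs with h1 <;> simp_all
    · rintro ⟨a, b⟩ hp
      have h1 : r a b := by simpa using hp
      by_cases h2 : r' a b
      · simp [hN, h1, h2]
      · simp [hN, h2, hr a b h1]
    · rintro ⟨a, b⟩ hp
      have h1 : r' a b := by simpa using hp
      by_cases h2 : r a b
      · simp [hN, h1, h2]
      · simp [hN, h2, hr' a b h1]
  rw [← key]
  refine Associated.prod _ _ _ fun p _ => ?_
  simp only [hN]
  split_ifs
  · rfl
  · exact hf p

/-- Reorienting a pair only changes a sign, so the ordering of `ι` by `e` may be replaced by any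
antisymmetric choice `r`, which need not be transitive. -/
theorem associated_det_vandermonde {ι : Type*} [Fintype ι] [DecidableEq ι]
    (e : ι ≃ Fin (Fintype.card ι)) (r : ι → ι → Prop) [DecidableRel r]
    (hr : ∀ a b, r a b → ¬ r b a) (h : ∀ a b, a ≠ b → r a b ∨ r b a) (v : ι → R) :
    Associated (vandermonde (v ∘ e.symm)).det (∏ p : ι × ι with r p.1 p.2, (v p.2 - v p.1)) := by
  have h1 : (vandermonde (v ∘ e.symm)).det =
      ∏ p : ι × ι with e p.1 < e p.2, (v p.2 - v p.1) := by
    rw [det_vandermonde, Finset.prod_sigma']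
    refine Finset.prod_bij' (fun p _ => (e.symm p.1, e.symm p.2)) (fun p _ => ⟨e p.1, e p.2⟩)
      ?_ ?_ ?_ ?_ ?_ <;> simp
  rw [h1]
  exact associated_prod_orientation (fun a b => e a < e b) r (fun a b => by simpa using le_of_lt) hr
    (fun a b hab => lt_or_gt_of_ne (e.injective.ne hab)) h _ fun p => associated_sub_comm _ _

variable {n : ℕ}

/-- The value `δ_m(l)`. -/
def deltaVal (n m : ℕ) (l : Fin n → R) : R :=
  ∏ p ∈ pairs n m, (∑ t ∈ p.2, l t - ∑ s ∈ p.1, l s)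

/-- The number of `k`-element subsets of an `n`-element set that contain one of two given points
and not the other. -/
def sepCount (n k : ℕ) : ℕ := if k = 0 then 0 else (n - 2).choose (k - 1)

/-- The product `∏_{2 ≤ m ≤ k} δ_m(l) ^ (n - 2m).choose (k - m)`. -/
def higherDeltaVal (n k : ℕ) (l : Fin n → R) : R :=
  ∏ m ∈ Finset.Icc 2 k, deltaVal n m l ^ (n - 2 * m).choose (k - m)

/-- Such pairs are exactly `(U ∪ p.1, U ∪ p.2)` with `U` a `(k - m)`-element subset of the
complement of `p.1 ∪ p.2`. -/
theorem card_powersetCard_pairs {k m : ℕ} {p : Finset (Fin n) × Finset (Fin n)}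
    (hp : p ∈ pairs n m) (hm : m ≤ k) :
    Finset.card {q : Set.powersetCard (Fin n) k × Set.powersetCard (Fin n) k |
      (q.1 : Finset (Fin n)) \ q.2 = p.1 ∧ (q.2 : Finset (Fin n)) \ q.1 = p.2} =
      (n - 2 * m).choose (k - m) := by
  obtain ⟨h1, h2, h3, -⟩ := mem_pairs.1 hp
  have hc : (Finset.univ \ (p.1 ∪ p.2)).card = n - 2 * m := by
    rw [Finset.card_sdiff_of_subset (Finset.subset_univ _), Finset.card_union_of_disjoint h3,
      h1, h2, Finset.card_univ, Fintype.card_fin, two_mul]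
  rw [← hc, ← Finset.card_powersetCard]
  refine Finset.card_bij' (fun q _ => (q.1 : Finset (Fin n)) ∩ q.2)
    (fun U hU => (⟨U ∪ p.1, ?_⟩, ⟨U ∪ p.2, ?_⟩)) ?_ ?_ ?_ ?_
  · obtain ⟨hU1, hU2⟩ := Finset.mem_powersetCard.1 hU
    have : Disjoint U p.1 := by
      rw [Finset.disjoint_left]
      intro x hx
      have := hU1 hx
      simp at this
      exact this.1
    rw [Set.powersetCard.mem_iff, Finset.card_union_of_disjoint this, hU2, h1]
    omega
  · obtain ⟨hU1, hU2⟩ := Finset.mem_powersetCard.1 hU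
    have : Disjoint U p.2 := by
      rw [Finset.disjoint_left]
      intro x hx
      have := hU1 hx
      simp at this
      exact this.2
    rw [Set.powersetCard.mem_iff, Finset.card_union_of_disjoint this, hU2, h2]
    omega
  · rintro ⟨⟨S, hS⟩, ⟨T, hT⟩⟩ hq
    simp only [Finset.mem_filter, Finset.mem_univ, true_and] at hq
    rw [Set.powersetCard.mem_iff] at hS hT
    rw [Finset.mem_powersetCard]
    constructor
    · intro x hx
      simp only [← hq.1, ← hq.2, Finset.mem_sdiff, Finset.mem_univ, Finset.mem_union, true_and]
      rw [Finset.mem_inter] at hx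
      tauto
    · have := Finset.card_inter_add_card_sdiff S T
      rw [hq.1, h1, hS] at this
      change (S ∩ T).card = _
      omega
  · intro U hU
    obtain ⟨hU1, hU2⟩ := Finset.mem_powersetCard.1 hU
    have hU3 : ∀ x ∈ U, x ∉ p.1 ∧ x ∉ p.2 := fun x hx => by simpa using hU1 hx
    simp only [Finset.mem_filter, Finset.mem_univ, true_and]
    constructor <;>
    · ext x
      have := hU3 x
      have h4 : x ∈ p.1 → x ∉ p.2 := fun h => Finset.disjoint_left.1 h3 h
      simp only [Finset.mem_sdiff, Finset.mem_union]
      tauto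
  · rintro ⟨⟨S, hS⟩, ⟨T, hT⟩⟩ hq
    simp only [Finset.mem_filter, Finset.mem_univ, true_and] at hq
    refine Prod.ext (Subtype.ext ?_) (Subtype.ext ?_)
    · change (S ∩ T) ∪ p.1 = S
      rw [← hq.1]
      ext x
      simp only [Finset.mem_inter, Finset.mem_union, Finset.mem_sdiff]
      tauto
    · change (S ∩ T) ∪ p.2 = T
      rw [← hq.2]
      ext x
      simp only [Finset.mem_inter, Finset.mem_union, Finset.mem_sdiff]
      tauto
  · intro U hU
    obtain ⟨hU1, hU2⟩ := Finset.mem_powersetCard.1 hU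
    ext x
    have h4 : x ∈ p.1 → x ∉ p.2 := fun h => Finset.disjoint_left.1 h3 h
    simp only [Finset.mem_inter, Finset.mem_union]
    tauto

theorem min_sdiff_lt_or {S T : Finset (Fin n)} (h : S ≠ T) (hc : S.card = T.card) :
    (S \ T).min < (T \ S).min ∨ (T \ S).min < (S \ T).min := by
  refine lt_or_gt_of_ne fun heq => ?_
  have hne : (S \ T).Nonempty := by
    rw [Finset.nonempty_iff_ne_empty, Ne, Finset.sdiff_eq_empty_iff_subset]
    exact fun hs => h (Finset.eq_of_subset_of_card_le hs hc.ge)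
  obtain ⟨m, hm⟩ := Finset.min_of_nonempty hne
  have h1 := Finset.mem_of_min hm
  have h2 := Finset.mem_of_min (heq.symm.trans hm)
  simp only [Finset.mem_sdiff] at h1 h2
  exact h1.2 h2.1

/-- The Vandermonde determinant of the sums `l_S`, where `S` runs over the `k`-element subsets. -/
theorem associated_det_vandermonde_sum (k : ℕ)
    (e : Set.powersetCard (Fin n) k ≃ Fin (Fintype.card (Set.powersetCard (Fin n) k)))
    (l : Fin n → R) :
    Associated
      (vandermonde ((fun s : Set.powersetCard (Fin n) k =>
        ∑ i ∈ (s : Finset (Fin n)), l i) ∘ e.symm)).det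
      (deltaVal n 1 l ^ sepCount n k * higherDeltaVal n k l) := by
  have hIcc : deltaVal n 1 l ^ sepCount n k * higherDeltaVal n k l =
      ∏ m ∈ Finset.Icc 1 k, deltaVal n m l ^ (n - 2 * m).choose (k - m) := by
    -- At `k = 0` truncated subtraction would turn `(n - 2).choose (k - 1)` into `1`; `sepCount` is
    -- set to `0` there, matching the empty product.
    rcases Nat.eq_zero_or_pos k with rfl | hk
    · simp [sepCount, higherDeltaVal]
    · rw [← Finset.mul_prod_Ioc_eq_prod_Icc (show 1 ≤ k from hk), sepCount, if_neg hk.ne',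
        higherDeltaVal]
      rfl
  set v : Set.powersetCard (Fin n) k → R := fun s => ∑ i ∈ (s : Finset (Fin n)), l i with hv
  -- This orientation places `(S \ T, T \ S)` in `pairs n m`. Since `l_T - l_S` depends only on
  -- these differences, the product is grouped by them.
  set r : Set.powersetCard (Fin n) k → Set.powersetCard (Fin n) k → Prop := fun S T =>
    ((S : Finset (Fin n)) \ T).min < ((T : Finset (Fin n)) \ S).min with hr
  refine (associated_det_vandermonde e r (fun a b h => not_lt.2 h.le)
    (fun a b hab => min_sdiff_lt_or (fun h => hab (Subtype.ext h))
      (a.2.trans b.2.symm)) v).trans (.of_eq ?_)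
  rw [hIcc]
  simp only [deltaVal, ← Finset.prod_pow]
  rw [Finset.prod_sigma', ← Finset.prod_fiberwise_of_maps_to
    (t := (Finset.Icc 1 k).sigma fun m => pairs n m)
    (g := fun q : Set.powersetCard (Fin n) k × Set.powersetCard (Fin n) k =>
      (⟨((q.1 : Finset (Fin n)) \ q.2).card,
        ((q.1 : Finset (Fin n)) \ q.2, (q.2 : Finset (Fin n)) \ q.1)⟩ :
        (_ : ℕ) × (Finset (Fin n) × Finset (Fin n))))]
  · refine Finset.prod_congr rfl ?_
    rintro ⟨m, p⟩ hp
    simp only [Finset.mem_sigma, Finset.mem_Icc] at hp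
    rw [← card_powersetCard_pairs hp.2 hp.1.2, ← Finset.prod_const]
    have hp' := mem_pairs.1 hp.2
    refine Finset.prod_congr ?_ ?_
    · ext q
      simp only [Finset.mem_filter, Finset.mem_univ, true_and, Sigma.mk.injEq, heq_eq_eq,
        Prod.ext_iff]
      constructor
      · tauto
      · rintro ⟨h1, h2⟩
        refine ⟨?_, ?_, h1, h2⟩
        · simp only [hr, h1, h2]
          exact hp'.2.2.2
        · rw [h1, hp'.1]
    · intro q hq
      simp only [Finset.mem_filter, Finset.mem_univ, true_and] at hq
      rw [← hq.1, ← hq.2]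
      simp only [hv]
      exact (Finset.sum_sdiff_sub_sum_sdiff).symm
  · rintro ⟨S, T⟩ hq
    simp only [Finset.mem_filter, Finset.mem_univ, true_and] at hq
    simp only [Finset.mem_sigma, Finset.mem_Icc, mem_pairs]
    have hS := S.2
    have hT := T.2
    rw [Set.powersetCard.mem_iff] at hS hT
    have h1 : ((T : Finset (Fin n)) \ S).card = ((S : Finset (Fin n)) \ T).card := by
      have h1 := Finset.card_inter_add_card_sdiff (S : Finset (Fin n)) T
      have h2 := Finset.card_inter_add_card_sdiff (T : Finset (Fin n)) S
      rw [Finset.inter_comm] at h2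
      change _ = S.1.card at h1
      change _ = T.1.card at h2
      omega
    refine ⟨⟨?_, ?_⟩, trivial, h1, ?_, hq⟩
    · rw [Nat.one_le_iff_ne_zero, Finset.card_ne_zero, Finset.nonempty_iff_ne_empty]
      intro h0
      simp [hr, h0] at hq
    · exact (Finset.card_le_card Finset.sdiff_subset).trans hS.le
    · rw [Finset.disjoint_left]
      simp only [Finset.mem_sdiff]
      tauto

/-- The number of subsets containing `i` and not `j`. -/
theorem card_sep (k : ℕ) {i j : Fin n} (hij : i ≠ j) :
    Finset.card {s : Set.powersetCard (Fin n) k |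
      i ∈ (s : Finset (Fin n)) ∧ j ∉ (s : Finset (Fin n))} = sepCount n k := by
  rcases Nat.eq_zero_or_pos k with rfl | hk
  · rw [sepCount, if_pos rfl, Finset.card_eq_zero, Finset.filter_eq_empty_iff]
    rintro ⟨s, hs⟩ -
    rw [Set.powersetCard.mem_iff, Finset.card_eq_zero] at hs
    simp [hs]
  rw [sepCount, if_neg hk.ne']
  have hc : (Finset.univ \ {i, j} : Finset (Fin n)).card = n - 2 := by
    rw [Finset.card_sdiff_of_subset (Finset.subset_univ _), Finset.card_pair hij,
      Finset.card_univ, Fintype.card_fin]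
  rw [← hc, ← Finset.card_powersetCard]
  refine Finset.card_bij' (fun q _ => (q : Finset (Fin n)).erase i)
    (fun U hU => ⟨insert i U, ?_⟩) ?_ ?_ ?_ ?_
  · obtain ⟨hU1, hU2⟩ := Finset.mem_powersetCard.1 hU
    have : i ∉ U := fun h => by simpa using hU1 h
    rw [Set.powersetCard.mem_iff, Finset.card_insert_of_notMem this, hU2]
    omega
  · rintro ⟨S, hS⟩ hq
    simp only [Finset.mem_filter, Finset.mem_univ, true_and] at hq
    rw [Set.powersetCard.mem_iff] at hS
    rw [Finset.mem_powersetCard]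
    constructor
    · intro x hx
      obtain ⟨hx1, hx2⟩ := Finset.mem_erase.1 hx
      have : x ≠ j := fun h => hq.2 (h ▸ hx2)
      simp [hx1, this]
    · change (S.erase i).card = _
      rw [Finset.card_erase_of_mem hq.1, hS]
  · intro U hU
    obtain ⟨hU1, hU2⟩ := Finset.mem_powersetCard.1 hU
    have : j ∉ U := fun h => by simpa using hU1 h
    simp [hij.symm, this]
  · rintro ⟨S, hS⟩ hq
    simp only [Finset.mem_filter, Finset.mem_univ, true_and] at hq
    refine Subtype.ext ?_
    exact Finset.insert_erase hq.1
  · intro U hU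
    obtain ⟨hU1, hU2⟩ := Finset.mem_powersetCard.1 hU
    have : i ∉ U := fun h => by simpa using hU1 h
    exact Finset.erase_insert this

theorem map_deltaVal {S : Type*} [CommRing S] (f : R →+* S) (m : ℕ) (l : Fin n → R) :
    f (deltaVal n m l) = deltaVal n m (f ∘ l) := by
  simp [deltaVal, map_prod, map_sum]

end Vandermonde

end Triangulant

/-! ### Discriminants in terms of eigenvalues -/

namespace Triangulant

open MvPolynomial

section Eigenvalue

theorem _root_.MvPolynomial.IsWeightedHomogeneous.aeval_isHomogeneous {σ τ R : Type*}
    [CommRing R] {w : σ → ℕ} {φ : MvPolynomial σ R} {d : ℕ} (hφ : IsWeightedHomogeneous w φ d)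
    {g : σ → MvPolynomial τ R} (hg : ∀ i, (g i).IsHomogeneous (w i)) :
    (aeval g φ).IsHomogeneous d := by
  rw [aeval_def, eval₂_eq]
  refine IsHomogeneous.sum _ _ _ fun s hs => ?_
  have h1 := (isHomogeneous_C τ (coeff s φ)).mul
    (IsHomogeneous.prod s.support (fun i => g i ^ s i) (fun i => w i * s i)
      fun i _ => (hg i).pow (s i))
  have h2 := hφ (mem_support_iff.1 hs)
  rw [Finsupp.weight_apply, Finsupp.sum] at h2
  rw [algebraMap_eq]
  convert h1 using 1
  rw [← h2, zero_add]
  exact Finset.sum_congr rfl fun i _ => by rw [smul_eq_mul, mul_comm]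

/-- Substituting forms of degree `w i` for the variables turns the weighted grading into the
ordinary one. -/
theorem homogeneousComponent_aeval {σ τ R : Type*} [CommRing R] (w : σ → ℕ)
    (φ : MvPolynomial σ R) (d : ℕ) {g : σ → MvPolynomial τ R}
    (hg : ∀ i, (g i).IsHomogeneous (w i)) :
    homogeneousComponent d (aeval g φ) = aeval g (weightedHomogeneousComponent w d φ) := by
  induction φ using MvPolynomial.induction_on' with
  | monomial s c =>
    have hm : IsWeightedHomogeneous w (monomial s c) (Finsupp.weight w s) :=
      isWeightedHomogeneous_monomial w s c rfl
    by_cases h : Finsupp.weight w s = d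
    · subst h
      rw [weightedHomogeneousComponent_of_mem hm, if_pos rfl,
        homogeneousComponent_of_mem (hm.aeval_isHomogeneous hg), if_pos rfl]
    · rw [weightedHomogeneousComponent_of_mem hm, if_neg (Ne.symm h),
        homogeneousComponent_of_mem (hm.aeval_isHomogeneous hg), if_neg (Ne.symm h), map_zero]
  | add p q hp hq => simp only [map_add, hp, hq]

variable {R : Type*} [CommRing R] {n : ℕ}

theorem aeval_esymmAlgEquiv_symm (p : MvPolynomial (Fin n) R) (hp : p.IsSymmetric) :
    aeval (fun i : Fin n => esymm (Fin n) R (i + 1))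
      ((esymmAlgEquiv (Fin n) R (Fintype.card_fin n)).symm ⟨p, hp⟩) = p := by
  rw [← esymmAlgHom_apply]
  exact congrArg Subtype.val
    ((esymmAlgEquiv (Fin n) R (Fintype.card_fin n)).apply_symm_apply ⟨p, hp⟩)

theorem esymm_isHomogeneous (m : ℕ) : (esymm (Fin n) R m).IsHomogeneous m := by
  refine IsHomogeneous.sum _ _ _ fun s hs => ?_
  have := IsHomogeneous.prod s (fun i : Fin n => (X i : MvPolynomial (Fin n) R)) (fun _ => 1)
    fun i _ => isHomogeneous_X R i
  simpa [(Finset.mem_powersetCard.1 hs).2] using this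

/-- The expression of `p` through elementary symmetric polynomials is unique, so it equals its own
component of weight `d`. The substituted coefficients of the characteristic polynomial have the same
degrees as the `e_m`. Homogeneity of `G_k` is used to recognize units among its divisors. -/
theorem eigenvaluePoly_isHomogeneous (p : MvPolynomial (Fin n) R) (hp : p.IsSymmetric) {d : ℕ}
    (hd : p.IsHomogeneous d) : (eigenvaluePoly p hp).IsHomogeneous d := by
  set q := (esymmAlgEquiv (Fin n) R (Fintype.card_fin n)).symm ⟨p, hp⟩ with hq
  have hqp := aeval_esymmAlgEquiv_symm p hp
  rw [← hq] at hqp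
  set w : Fin n → ℕ := fun i => i + 1 with hw
  have h1 : aeval (fun i : Fin n => esymm (Fin n) R (i + 1))
      (weightedHomogeneousComponent w d q) = p := by
    rw [← homogeneousComponent_aeval w q d fun i => esymm_isHomogeneous _, hqp,
      homogeneousComponent_eq_self hd]
  have h2 : weightedHomogeneousComponent w d q = q := by
    apply esymmAlgHom_injective (σ := Fin n) R (n := n) (by simp)
    apply Subtype.ext
    rw [esymmAlgHom_apply, esymmAlgHom_apply, h1, hqp]
  have h3 : IsWeightedHomogeneous w q d :=
    h2 ▸ weightedHomogeneousComponent_isWeightedHomogeneous d q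
  rw [eigenvaluePoly, ← hq]
  refine h3.aeval_isHomogeneous fun i => ?_
  have h4 := Matrix.charpoly.univ_coeff_isHomogeneous R (Fin n) (n - ((i : ℕ) + 1)) (i + 1)
    (by rw [Fintype.card_fin]; omega)
  have h5 := h4.C_mul ((-1) ^ ((i : ℕ) + 1))
  simpa using h5

/-- By Vieta's formulas, the signed coefficients of the characteristic polynomial are the elementary
symmetric functions of `l`. -/
theorem aeval_eigenvaluePoly {S : Type*} [CommRing S] [Algebra R S]
    (p : MvPolynomial (Fin n) R) (hp : p.IsSymmetric) (A : Matrix (Fin n) (Fin n) S)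
    (l : Fin n → S) (hA : A.charpoly = ∏ i, (Polynomial.X - Polynomial.C (l i))) :
    aeval (fun x : Fin n × Fin n => A x.1 x.2) (eigenvaluePoly p hp) = aeval l p := by
  conv_rhs => rw [← aeval_esymmAlgEquiv_symm p hp, ← AlgHom.comp_apply, comp_aeval]
  rw [eigenvaluePoly, ← AlgHom.comp_apply, comp_aeval]
  congr 2
  funext i
  have h1 : aeval (fun x : Fin n × Fin n => A x.1 x.2)
      ((Matrix.charpoly.univ R (Fin n)).coeff (n - ((i : ℕ) + 1))) =
      A.charpoly.coeff (n - ((i : ℕ) + 1)) :=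
    Matrix.charpoly.univ_coeff_eval₂Hom (Fin n) (algebraMap R S) (fun x => A x.1 x.2) _
  have hn : n - (n - ((i : ℕ) + 1)) = i + 1 := by omega
  have h2 := Multiset.prod_X_sub_C_coeff (Finset.univ.val.map l) (k := n - ((i : ℕ) + 1))
    (by simp)
  rw [Multiset.map_map] at h2
  simp only [Multiset.card_map, Finset.card_val, Finset.card_univ, Fintype.card_fin, hn] at h2
  have h3 : ∏ i, (Polynomial.X - Polynomial.C (l i)) =
      (Multiset.map ((fun t => Polynomial.X - Polynomial.C t) ∘ l) Finset.univ.val).prod := rfl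
  rw [map_mul, h1, hA, aeval_esymm_eq_multiset_esymm, h3, h2, map_pow, map_neg, map_one, ← mul_assoc, ← mul_pow]
  simp

theorem aeval_delta {S : Type*} [CommRing S] [Algebra R S] (m : ℕ) (l : Fin n → S) :
    aeval l (delta R n m) = deltaVal n m l := by
  simp [delta, deltaVal, map_prod, map_sum]

theorem delta_isHomogeneous (m : ℕ) : (delta R n m).IsHomogeneous (pairs n m).card := by
  have := IsHomogeneous.prod (pairs n m)
    (fun p => (∑ t ∈ p.2, X t - ∑ s ∈ p.1, X s : MvPolynomial (Fin n) R)) (fun _ => 1)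
    fun p _ => (IsHomogeneous.sum _ _ _ fun i _ => isHomogeneous_X R i).sub
      (IsHomogeneous.sum _ _ _ fun i _ => isHomogeneous_X R i)
  simpa [delta] using this

theorem aeval_disc {S : Type*} [CommRing S] [Algebra R S] {m : ℕ} (hm : 2 ≤ m)
    (A : Matrix (Fin n) (Fin n) S)
    (l : Fin n → S) (hA : A.charpoly = ∏ i, (Polynomial.X - Polynomial.C (l i))) :
    aeval (fun x : Fin n × Fin n => A x.1 x.2) (disc R n m) = deltaVal n m l := by
  rw [disc, dif_pos hm, aeval_eigenvaluePoly _ _ A l hA, aeval_delta]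

theorem aeval_disc_eq_zero {S : Type*} [CommRing S] [Algebra R S] {m : ℕ}
    (A : Matrix (Fin n) (Fin n) S)
    (l : Fin n → S) (hA : A.charpoly = ∏ i, (Polynomial.X - Polynomial.C (l i)))
    (hl : deltaVal n m l = 0) :
    aeval (fun x : Fin n × Fin n => A x.1 x.2) (disc R n m) = 0 := by
  rw [disc]
  split_ifs
  · rw [aeval_eigenvaluePoly _ _ A l hA, aeval_delta, hl]
  · rw [aeval_eigenvaluePoly _ _ A l hA, aeval_delta, hl]
  · rw [aeval_eigenvaluePoly _ _ A l hA, map_pow, aeval_delta, hl, zero_pow two_ne_zero]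

theorem aeval_disc_one {S : Type*} [CommRing S] [Algebra ℤ S]
    (A : Matrix (Fin n) (Fin n) S)
    (l : Fin n → S) (hA : A.charpoly = ∏ i, (Polynomial.X - Polynomial.C (l i))) :
    aeval (fun x : Fin n × Fin n => A x.1 x.2) (disc ℤ n 1) = deltaVal n 1 l ^ 2 := by
  rw [disc, dif_neg (by norm_num), dif_neg (by rw [ringChar.eq_zero]; norm_num),
    aeval_eigenvaluePoly _ _ A l hA, map_pow, aeval_delta]

theorem aeval_gPoly {S : Type*} [CommRing S] [Algebra ℤ S] (k : ℕ)
    (A : Matrix (Fin n) (Fin n) S)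
    (l : Fin n → S) (hA : A.charpoly = ∏ i, (Polynomial.X - Polynomial.C (l i))) :
    aeval (fun x : Fin n × Fin n => A x.1 x.2) (gPoly n k) =
      higherDeltaVal n k l ^ n.choose k := by
  rw [gPoly, map_prod, higherDeltaVal, ← Finset.prod_pow]
  refine Finset.prod_congr rfl fun m hm => ?_
  rw [map_pow, aeval_disc (Finset.mem_Icc.1 hm).1 A l hA, ← pow_mul, mul_comm]

theorem gPoly_isHomogeneous (n k : ℕ) : ∃ d, (gPoly n k).IsHomogeneous d := by
  refine ⟨_, IsHomogeneous.prod _ _ (fun m => (pairs n m).card *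
    (n.choose k * (n - 2 * m).choose (k - m))) fun m hm => ?_⟩
  rw [disc, dif_pos (Finset.mem_Icc.1 hm).1]
  exact (eigenvaluePoly_isHomogeneous _ _ (delta_isHomogeneous m)).pow _

end Eigenvalue

end Triangulant

/-! ### Eigenvectors and relative primality -/

namespace Triangulant

open Matrix

theorem card_powersetCard_fin (n k : ℕ) :
    Fintype.card (Set.powersetCard (Fin n) k) = n.choose k := by
  rw [← Nat.card_eq_fintype_card, Set.powersetCard.card, Nat.card_eq_fintype_card,
    Fintype.card_fin]

section Krylov

variable {R : Type*} [CommRing R] {n : ℕ}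

/-- The triangulant of the matrices `A_k` and `B_k`, where `W` and `Q` diagonalize `A` and `B`. -/
theorem triangulant_powMatrix_of_intertwine (k : ℕ) (l m : Fin n → R)
    {A B W Q : Matrix (Fin n) (Fin n) R} (hW : W * A = diagonal l * W)
    (hQ : B * Q = Q * diagonal m) :
    Associated ((compound k W).det ^ n.choose k * triangulant (powMatrix k A) (powMatrix k B) *
        (compound k Q).det ^ n.choose k)
      ((deltaVal n 1 l ^ sepCount n k * higherDeltaVal n k l) ^ n.choose k *
        (deltaVal n 1 m ^ sepCount n k * higherDeltaVal n k m) ^ n.choose k *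
        ∏ s, ∏ t, compound k (W * Q) s t) := by
  have h1 := compound_mul_powMatrix k hW
  have h2 := powMatrix_mul_compound k hQ
  rw [powMatrix_diagonal] at h1 h2
  set e := Fintype.equivFin (Set.powersetCard (Fin n) k)
  have h3 := triangulant_of_intertwine e _ _ h1 h2
  rw [← compound_mul] at h3
  rw [← card_powersetCard_fin]
  refine h3.trans (Associated.mul_right (Associated.mul_mul ?_ ?_) _)
  · exact (associated_det_vandermonde_sum k e l).pow_pow
  · exact (associated_det_vandermonde_sum k e m).pow_pow

theorem deltaVal_one (l : Fin n → R) :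
    deltaVal n 1 l = ∏ p : Fin n × Fin n with p.1 < p.2, (l p.2 - l p.1) := by
  rw [deltaVal]
  symm
  refine Finset.prod_bij (fun p _ => ({p.1}, {p.2})) ?_ ?_ ?_ ?_
  · rintro ⟨i, j⟩ h
    simp only [Finset.mem_filter, Finset.mem_univ, true_and] at h
    simp [mem_pairs, h, h.ne]
  · rintro ⟨i, j⟩ _ ⟨i', j'⟩ _ h
    simpa using h
  · rintro ⟨S, T⟩ h
    obtain ⟨h1, h2, h3, h4⟩ := mem_pairs.1 h
    obtain ⟨i, hi⟩ := Finset.card_eq_one.1 h1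
    obtain ⟨j, hj⟩ := Finset.card_eq_one.1 h2
    simp only at hi hj h4
    subst hi hj
    refine ⟨(i, j), ?_, rfl⟩
    simpa using h4
  · rintro ⟨i, j⟩ _
    simp

theorem det_vandermonde_eq_deltaVal (l : Fin n → R) : (vandermonde l).det = deltaVal n 1 l := by
  rw [deltaVal_one, det_vandermonde, Finset.prod_sigma']
  refine Finset.prod_bij' (fun p _ => (p.1, p.2)) (fun p _ => ⟨p.1, p.2⟩)
    ?_ ?_ ?_ ?_ ?_ <;> simp

theorem associated_prod_erase (l : Fin n → R) :
    Associated (∏ i, ∏ j ∈ Finset.univ.erase i, (l i - l j)) (deltaVal n 1 l ^ 2) := by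
  have h1 : ∏ i, ∏ j ∈ Finset.univ.erase i, (l i - l j) =
      (∏ p : Fin n × Fin n with p.1 < p.2, (l p.1 - l p.2)) *
        ∏ p : Fin n × Fin n with p.1 < p.2, (l p.2 - l p.1) := by
    have h2 : ∏ p : Fin n × Fin n with p.1 < p.2, (l p.2 - l p.1) =
        ∏ p : Fin n × Fin n with p.2 < p.1, (l p.1 - l p.2) := by
      refine Finset.prod_bij' (fun p _ => p.swap) (fun p _ => p.swap) ?_ ?_ ?_ ?_ ?_ <;> simp
    rw [h2, ← Finset.prod_union]
    · rw [Finset.prod_sigma']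
      refine Finset.prod_bij' (fun p _ => (p.1, p.2)) (fun p _ => ⟨p.1, p.2⟩) ?_ ?_ ?_ ?_ ?_
      · rintro ⟨i, j⟩ h
        simp only [Finset.mem_sigma, Finset.mem_univ, Finset.mem_erase, true_and, and_true] at h
        simpa using lt_or_gt_of_ne (Ne.symm h)
      · rintro ⟨i, j⟩ h
        simp only [Finset.mem_union, Finset.mem_filter, Finset.mem_univ, true_and] at h
        rcases h with h | h
        · simpa using h.ne'
        · simpa using h.ne
      all_goals simp
    · rw [Finset.disjoint_left]
      rintro ⟨i, j⟩ h
      simp only [Finset.mem_filter, Finset.mem_univ, true_and] at h ⊢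
      exact h.asymm
  rw [h1, deltaVal_one, sq]
  exact (Associated.prod _ _ _ fun p _ => associated_sub_comm _ _).mul_right _

/-- The matrix with rows `u A ^ j`, where `u = (1, …, 1)`. -/
def krylov (A : Matrix (Fin n) (Fin n) R) : Matrix (Fin n) (Fin n) R :=
  Matrix.of fun j => (fun _ => 1) ᵥ* A ^ (j : ℕ)

theorem map_krylov {S : Type*} [CommRing S] (f : R →+* S) (A : Matrix (Fin n) (Fin n) R) :
    (krylov A).map f = krylov (A.map f) := by
  ext i j
  have h : (A.map f) ^ (i : ℕ) = (A ^ (i : ℕ)).map f := by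
    change f.mapMatrix A ^ (i : ℕ) = f.mapMatrix (A ^ (i : ℕ))
    rw [map_pow]
  simp [krylov, h, vecMul, dotProduct, map_sum]

theorem krylov_diagonal (l : Fin n → R) : krylov (diagonal l) = (vandermonde l)ᵀ := by
  ext i j
  simp [krylov, diagonal_pow, vandermonde_apply, vecMul_diagonal]

theorem det_krylov_diagonal (l : Fin n → R) : (krylov (diagonal l)).det = deltaVal n 1 l := by
  rw [krylov_diagonal, det_transpose, det_vandermonde_eq_deltaVal]

open Polynomial in
/-- A matrix whose characteristic polynomial splits has a matrix of left eigenvectors, the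
determinant of which divides `δ_1 ^ 2` times the determinant of the Krylov matrix. -/
theorem exists_intertwine (A : Matrix (Fin n) (Fin n) R) (l : Fin n → R)
    (hA : A.charpoly = ∏ i, (X - C (l i))) :
    ∃ W : Matrix (Fin n) (Fin n) R, W * A = diagonal l * W ∧
      W.det ∣ deltaVal n 1 l ^ 2 * (krylov A).det := by
  nontriviality R
  -- `q i` is the characteristic polynomial without the factor `X - l i`. By Cayley–Hamilton the
  -- rows of `q i` at `A` are left eigenvectors for `l i`; row `i` of `W` is their sum.
  set q : Fin n → R[X] := fun i => ∏ j ∈ Finset.univ.erase i, (X - C (l j)) with hq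
  have hqX : ∀ i, q i * (X - C (l i)) = A.charpoly := by
    intro i
    rw [hA, ← Finset.prod_erase_mul _ _ (Finset.mem_univ i)]
  have hdeg : ∀ i, (q i).natDegree < n := by
    intro i
    have hn : 0 < n := i.pos
    rw [hq]
    simp only
    rw [natDegree_prod_of_monic _ _ fun j _ => monic_X_sub_C _]
    simp [hn]
  set W : Matrix (Fin n) (Fin n) R :=
    Matrix.of fun i => (fun _ => 1) ᵥ* (aeval A (q i)) with hW
  set E : Matrix (Fin n) (Fin n) R := Matrix.of fun i j => (q i).coeff j with hE
  have hWE : W = E * krylov A := by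
    ext i j
    simp only [hW, hE, of_apply, Matrix.mul_apply, krylov]
    rw [aeval_eq_sum_range' (hdeg i), vecMul_sum, Finset.sum_apply, Finset.sum_range]
    simp [vecMul_smul]
  -- Lagrange interpolation: `q i` vanishes at every `l j` with `j ≠ i`.
  have hEV : E * (vandermonde l)ᵀ =
      diagonal fun i => ∏ j ∈ Finset.univ.erase i, (l i - l j) := by
    ext i i'
    have : (E * (vandermonde l)ᵀ) i i' = (q i).eval (l i') := by
      rw [eval_eq_sum_range' (hdeg i), Matrix.mul_apply, Finset.sum_range]
      simp [hE, vandermonde_apply]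
    rw [this, hq]
    simp only
    rw [eval_prod]
    by_cases h : i = i'
    · subst h
      simp
    · rw [diagonal_apply_ne _ h]
      exact Finset.prod_eq_zero (i := i') (by simp [Ne.symm h]) (by simp)
  refine ⟨W, ?_, ?_⟩
  · ext i j
    rw [diagonal_mul]
    have h1 : aeval A (q i) * A = l i • aeval A (q i) := by
      have h2 := congrArg (aeval A) (hqX i)
      rw [aeval_self_charpoly, map_mul, map_sub, aeval_X, aeval_C, mul_sub, sub_eq_zero] at h2
      rw [h2, ← Algebra.commutes, Algebra.smul_def]
    have h3 : W i ᵥ* A = l i • W i := by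
      change ((fun _ => 1) ᵥ* (aeval A (q i))) ᵥ* A = l i • ((fun _ => 1) ᵥ* (aeval A (q i)))
      rw [vecMul_vecMul, h1, vecMul_smul]
    exact congrFun h3 j
  · refine (Dvd.intro (vandermonde l).det ?_).trans ((associated_prod_erase l).mul_right _).dvd
    rw [hWE, det_mul, mul_right_comm, ← det_transpose (vandermonde l), ← det_mul E, hEV,
      det_diagonal]

end Krylov

/-! ### Coprimality of linear forms, and divisors of homogeneous polynomials -/

section RelPrime

open MvPolynomial

theorem irreducible_X_sub_X {σ : Type*} {i j : σ} (hij : i ≠ j) :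
    Irreducible (X i - X j : MvPolynomial σ ℤ) := by
  classical
  have hne : (Finsupp.single i 1 : σ →₀ ℕ) ≠ Finsupp.single j 1 := fun h =>
    hij (Finsupp.single_left_injective one_ne_zero h)
  have hc : coeff (Finsupp.single i 1) (X i - X j : MvPolynomial σ ℤ) = 1 := by
    rw [coeff_sub, coeff_X, coeff_X, if_neg (Ne.symm hne), if_pos rfl, sub_zero]
  have h0 : (X i - X j : MvPolynomial σ ℤ) ≠ 0 := fun h => by
    rw [h, coeff_zero] at hc
    exact zero_ne_one hc
  refine irreducible_of_totalDegree_eq_one ?_ fun x hx => ?_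
  · exact ((isHomogeneous_X ℤ i).sub (isHomogeneous_X ℤ j)).totalDegree h0
  · have := hx (Finsupp.single i 1)
    rw [hc] at this
    exact isUnit_of_dvd_one this

/-- At the indicator function of `r` the irreducible form `X i - X j` vanishes, while the other form
takes the value `1` or `-1`. -/
theorem isRelPrime_X_sub_X {σ : Type*} [DecidableEq σ] {i j : σ} (hij : i ≠ j) {S T : Finset σ}
    (hST : Disjoint S T) {r : σ} (hr : r ∈ S ∪ T) (hri : r ≠ i) (hrj : r ≠ j) :
    IsRelPrime (X i - X j : MvPolynomial σ ℤ) (∑ t ∈ T, X t - ∑ s ∈ S, X s) := by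
  rw [(irreducible_X_sub_X hij).isRelPrime_iff_not_dvd]
  intro h
  have hev := map_dvd (eval fun s => if s = r then (1 : ℤ) else 0) h
  simp only [map_sub, map_sum, eval_X, Finset.sum_ite_eq', if_neg hri.symm, if_neg hrj.symm,
    sub_zero, zero_dvd_iff] at hev
  rcases Finset.mem_union.1 hr with hr | hr
  · simp [hr, Finset.disjoint_left.1 hST hr] at hev
  · simp [hr, Finset.disjoint_right.1 hST hr] at hev

/-- If `g = p * q`, a monomial of lowest degree in `q` survives in `g` because the constant term of
`p` is a unit, so it has degree `d`. Hence `q` already has the full degree of `g`, and `p` is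
constant. -/
theorem isUnit_of_dvd_isHomogeneous {σ R : Type*} [CommRing R] [IsDomain R]
    {p g : MvPolynomial σ R} {d : ℕ} (hg : g.IsHomogeneous d) (hg0 : g ≠ 0) (h : p ∣ g)
    (hp : IsUnit (constantCoeff p)) : IsUnit p := by
  classical
  obtain ⟨q, rfl⟩ := h
  have hp0 : p ≠ 0 := left_ne_zero_of_mul hg0
  have hq0 : q ≠ 0 := right_ne_zero_of_mul hg0
  obtain ⟨m, hm, hmin⟩ := q.support.exists_min_image (fun m => m.degree)
    (support_nonempty.2 hq0)
  have hc : coeff m (p * q) = constantCoeff p * coeff m q := by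
    rw [coeff_mul, Finset.sum_eq_single (0, m)]
    · rfl
    · rintro ⟨a, b⟩ hab hne
      rw [Finset.HasAntidiagonal.mem_antidiagonal] at hab
      by_contra h0
      have hb : b ∈ q.support := mem_support_iff.2 (right_ne_zero_of_mul h0)
      have h1 := hmin b hb
      have h2 : a.degree + b.degree = m.degree := by rw [← map_add, hab]
      have h3 : a = 0 := (Finsupp.degree_eq_zero_iff a).1 (by omega)
      subst h3
      simp_all
    · intro h; simp at h
  have hmd : m.degree = d := by
    by_contra hne
    have := hg.coeff_eq_zero hne
    rw [hc] at this
    exact mem_support_iff.1 hm ((hp.mul_right_eq_zero).1 this)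
  have h1 : d ≤ q.totalDegree := by
    rw [← hmd]
    exact le_totalDegree hm
  have h2 := totalDegree_mul_of_isDomain hp0 hq0
  rw [hg.totalDegree hg0] at h2
  have h3 : p.totalDegree = 0 := by omega
  rw [totalDegree_eq_zero_iff_eq_C] at h3
  rw [h3]
  exact hp.map C

end RelPrime

end Triangulant

/-! ### The triangulant is divisible by the discriminants of order at least two -/

namespace Triangulant

open MvPolynomial

/-! ### Generic matrices, and coprimality of `G_k` with the cleared denominators -/

section Generic

theorem nonempty_of_mem_pairs {n m : ℕ} {p : Finset (Fin n) × Finset (Fin n)}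
    (hp : p ∈ pairs n m) : p.1.Nonempty := by
  obtain ⟨-, -, -, h4⟩ := mem_pairs.1 hp
  rw [Finset.nonempty_iff_ne_empty]
  intro h
  rw [h, Finset.min_empty] at h4
  exact not_top_lt h4

theorem deltaVal_X_ne_zero {R τ : Type*} [CommRing R] [IsDomain R] (n m : ℕ) (f : Fin n ↪ τ) :
    deltaVal n m (fun i => (X (f i) : MvPolynomial τ R)) ≠ 0 := by
  classical
  refine Finset.prod_ne_zero_iff.2 fun p hp h => ?_
  obtain ⟨i, hi⟩ := nonempty_of_mem_pairs hp
  have h3 := (mem_pairs.1 hp).2.2.1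
  have := congrArg (eval fun s => if s = f i then (1 : R) else 0) h
  simp [hi, Finset.disjoint_left.1 h3 hi] at this

theorem higherDeltaVal_X_ne_zero {R τ : Type*} [CommRing R] [IsDomain R] (n k : ℕ)
    (f : Fin n ↪ τ) : higherDeltaVal n k (fun i => (X (f i) : MvPolynomial τ R)) ≠ 0 :=
  Finset.prod_ne_zero_iff.2 fun m _ => pow_ne_zero _ (deltaVal_X_ne_zero n m f)

theorem isRelPrime_deltaVal {τ : Type*} {n m : ℕ} (hm : 2 ≤ m) (f g : Fin n ↪ τ) :
    IsRelPrime (deltaVal n 1 (fun i => (X (g i) : MvPolynomial τ ℤ)))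
      (deltaVal n m (fun i => (X (f i) : MvPolynomial τ ℤ))) := by
  classical
  rw [deltaVal_one]
  refine IsRelPrime.prod_left fun q hq => IsRelPrime.prod_right fun p hp => ?_
  obtain ⟨h1, h2, h3, -⟩ := mem_pairs.1 hp
  have hne : g q.2 ≠ g q.1 := fun h => by
    have := g.injective h
    simp [this] at hq
  have hd : Disjoint (p.1.map f) (p.2.map f) := (Finset.disjoint_map f).2 h3
  -- A factor of `δ_m` with `m ≥ 2` involves at least four variables, so one of them lies outside
  -- the two given ones.
  obtain ⟨r, hr, hr'⟩ : ∃ r ∈ p.1.map f ∪ p.2.map f, r ∉ ({g q.2, g q.1} : Finset τ) := by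
    apply Finset.exists_mem_notMem_of_card_lt_card
    rw [Finset.card_union_of_disjoint hd, Finset.card_map, Finset.card_map, h1, h2]
    exact lt_of_le_of_lt Finset.card_le_two (by omega)
  simp only [Finset.mem_insert, Finset.mem_singleton, not_or] at hr'
  have := isRelPrime_X_sub_X hne hd hr hr'.1 hr'.2
  simpa using this

theorem isRelPrime_higherDeltaVal {τ : Type*} (n k : ℕ) (f g : Fin n ↪ τ) :
    IsRelPrime (higherDeltaVal n k (fun i => (X (f i) : MvPolynomial τ ℤ)))
      (deltaVal n 1 (fun i => (X (g i) : MvPolynomial τ ℤ))) :=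
  IsRelPrime.prod_left fun _ hm =>
    (isRelPrime_deltaVal (Finset.mem_Icc.1 hm).1 f g).symm.pow_left

variable {n : ℕ}

/-- Evaluation of a polynomial in the entries of two matrices. -/
noncomputable def evalPair (R : Type*) {S : Type*} [CommRing R] [CommRing S] [Algebra R S]
    (A B : Matrix (Fin n) (Fin n) S) :
    MvPolynomial ((Fin n × Fin n) ⊕ (Fin n × Fin n)) R →ₐ[R] S :=
  aeval (Sum.elim (fun x => A x.1 x.2) (fun x => B x.1 x.2))

section

variable {R S : Type*} [CommRing R] [CommRing S] [Algebra R S] (A B : Matrix (Fin n) (Fin n) S)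

theorem evalPair_rename_inl (p : MvPolynomial (Fin n × Fin n) R) :
    evalPair R A B (rename Sum.inl p) = aeval (fun x : Fin n × Fin n => A x.1 x.2) p := by
  rw [evalPair, aeval_rename]
  rfl

theorem evalPair_rename_inr (p : MvPolynomial (Fin n × Fin n) R) :
    evalPair R A B (rename Sum.inr p) = aeval (fun x : Fin n × Fin n => B x.1 x.2) p := by
  rw [evalPair, aeval_rename]
  rfl

theorem genericA_map [Algebra ℤ S] : (genericA n).map (evalPair ℤ A B) = A := by
  ext i j
  simp [genericA, evalPair]

theorem genericB_map [Algebra ℤ S] : (genericB n).map (evalPair ℤ A B) = B := by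
  ext i j
  simp [genericB, evalPair]

theorem evalPair_triangulant [Algebra ℤ S] (k : ℕ) :
    evalPair ℤ A B (triangulant (powMatrix k (genericA n)) (powMatrix k (genericB n))) =
      triangulant (powMatrix k A) (powMatrix k B) := by
  have := map_triangulant (evalPair ℤ A B).toRingHom (powMatrix k (genericA n))
    (powMatrix k (genericB n))
  rw [map_powMatrix, map_powMatrix] at this
  refine this.trans ?_
  congr 2
  · exact genericA_map A B
  · exact genericB_map A B

theorem evalPair_generic [Algebra ℤ S] (p : MvPolynomial ((Fin n × Fin n) ⊕ (Fin n × Fin n)) ℤ) {f :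
    MvPolynomial ((Fin n × Fin n) ⊕ (Fin n × Fin n)) ℤ →+* S} :
    evalPair ℤ ((genericA n).map f) ((genericB n).map f) p = f p := by
  suffices h : (evalPair ℤ ((genericA n).map f) ((genericB n).map f) : _ →+* S) = f from
    congrArg (fun g : _ →+* S => g p) h
  apply MvPolynomial.ringHom_ext
  · intro r
    simp
  · rintro (x | x) <;> simp [evalPair, genericA, genericB]

end

/-- The factor by which the triangulant is multiplied when denominators are cleared. -/
noncomputable def clearingFactor (n : ℕ) :
    MvPolynomial ((Fin n × Fin n) ⊕ (Fin n × Fin n)) ℤ :=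
  (rename Sum.inl (disc ℤ n 1) * (krylov (genericA n)).det) *
    (rename Sum.inr (disc ℤ n 1) * (krylov (genericB n).transpose).det)

theorem evalPair_clearingFactor {S : Type*} [CommRing S] [Algebra ℤ S] {A B : Matrix (Fin n) (Fin n) S}
    {l m : Fin n → S}
    (hA : A.charpoly = ∏ i, (Polynomial.X - Polynomial.C (l i)))
    (hB : B.charpoly = ∏ i, (Polynomial.X - Polynomial.C (m i))) :
    evalPair ℤ A B (clearingFactor n) = (deltaVal n 1 l ^ 2 * (krylov A).det) *
      (deltaVal n 1 m ^ 2 * (krylov B.transpose).det) := by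
  have h1 : evalPair ℤ A B (krylov (genericA n)).det = (krylov A).det := by
    have := RingHom.map_det (evalPair ℤ A B).toRingHom (krylov (genericA n))
    refine this.trans ?_
    congr 1
    refine (map_krylov _ _).trans ?_
    congr 1
    exact genericA_map A B
  have h2 : evalPair ℤ A B (krylov (genericB n).transpose).det = (krylov B.transpose).det := by
    have := RingHom.map_det (evalPair ℤ A B).toRingHom (krylov (genericB n).transpose)
    refine this.trans ?_
    congr 1
    refine (map_krylov _ _).trans ?_
    congr 1
    exact congrArg Matrix.transpose (genericB_map A B)
  rw [clearingFactor, map_mul, map_mul, map_mul, h1, h2, evalPair_rename_inl,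
    evalPair_rename_inr, aeval_disc_one A l hA, aeval_disc_one B m hB]

theorem charpoly_diagonal {S : Type*} [CommRing S] (l : Fin n → S) :
    (Matrix.diagonal l).charpoly = ∏ i, (Polynomial.X - Polynomial.C (l i)) := by
  rw [Matrix.charpoly, Matrix.charmatrix_diagonal, Matrix.det_diagonal]

theorem gPoly_isHomogeneous_mul (n k : ℕ) : ∃ d, (rename Sum.inl (gPoly n k) *
    rename Sum.inr (gPoly n k) :
      MvPolynomial ((Fin n × Fin n) ⊕ (Fin n × Fin n)) ℤ).IsHomogeneous d := by
  obtain ⟨d, hd⟩ := gPoly_isHomogeneous n k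
  exact ⟨d + d, hd.rename_isHomogeneous.mul hd.rename_isHomogeneous⟩

/-- Evaluation at two generic diagonal matrices. -/
noncomputable def evalDiagonal (n : ℕ) :
    MvPolynomial ((Fin n × Fin n) ⊕ (Fin n × Fin n)) ℤ →ₐ[ℤ] MvPolynomial (Fin n ⊕ Fin n) ℤ :=
  evalPair ℤ (Matrix.diagonal fun i => X (Sum.inl i)) (Matrix.diagonal fun i => X (Sum.inr i))

theorem evalDiagonal_gPoly (n k : ℕ) :
    evalDiagonal n (rename Sum.inl (gPoly n k) * rename Sum.inr (gPoly n k)) =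
      higherDeltaVal n k (fun i => X (Function.Embedding.inl i)) ^ n.choose k *
        higherDeltaVal n k (fun i => X (Function.Embedding.inr i)) ^ n.choose k := by
  rw [evalDiagonal, map_mul, evalPair_rename_inl, evalPair_rename_inr,
    aeval_gPoly k _ _ (charpoly_diagonal _), aeval_gPoly k _ _ (charpoly_diagonal _)]
  rfl

theorem gPoly_mul_ne_zero (n k : ℕ) : (rename Sum.inl (gPoly n k) * rename Sum.inr (gPoly n k) :
      MvPolynomial ((Fin n × Fin n) ⊕ (Fin n × Fin n)) ℤ) ≠ 0 := by
  intro h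
  have := evalDiagonal_gPoly n k
  rw [h, map_zero] at this
  exact mul_ne_zero (pow_ne_zero _ (higherDeltaVal_X_ne_zero n k _))
    (pow_ne_zero _ (higherDeltaVal_X_ne_zero n k _)) this.symm

theorem isRelPrime_gPoly_clearingFactor (n k : ℕ) :
    IsRelPrime (rename Sum.inl (gPoly n k) * rename Sum.inr (gPoly n k)) (clearingFactor n) := by
  obtain ⟨d, hd⟩ := gPoly_isHomogeneous_mul n k
  intro p hp1 hp2
  refine isUnit_of_dvd_isHomogeneous hd (gPoly_mul_ne_zero n k) hp1 ?_
  have h1 : IsRelPrime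
      (evalDiagonal n (rename Sum.inl (gPoly n k) * rename Sum.inr (gPoly n k)))
      (evalDiagonal n (clearingFactor n)) := by
    -- For diagonal matrices the Krylov matrices built from `(1, …, 1)` are transposed Vandermonde
    -- matrices, so only powers of `δ_1` appear.
    have hz : evalDiagonal n (clearingFactor n) =
        (deltaVal n 1 (fun i => X (Function.Embedding.inl i)) ^ 2 *
          deltaVal n 1 (fun i => X (Function.Embedding.inl i))) *
        (deltaVal n 1 (fun i => X (Function.Embedding.inr i)) ^ 2 *
          deltaVal n 1 (fun i => X (Function.Embedding.inr i))) := by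
      rw [evalDiagonal, evalPair_clearingFactor (charpoly_diagonal _) (charpoly_diagonal _),
        Matrix.diagonal_transpose, det_krylov_diagonal, det_krylov_diagonal]
      rfl
    rw [evalDiagonal_gPoly, hz]
    have h := fun f g : Fin n ↪ Fin n ⊕ Fin n => isRelPrime_higherDeltaVal n k f g
    refine IsRelPrime.mul_left (IsRelPrime.mul_right (IsRelPrime.mul_right ?_ ?_)
      (IsRelPrime.mul_right ?_ ?_)) (IsRelPrime.mul_right (IsRelPrime.mul_right ?_ ?_)
      (IsRelPrime.mul_right ?_ ?_))
    · exact (h _ _).pow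
    · exact (h _ _).pow_left
    · exact (h _ _).pow
    · exact (h _ _).pow_left
    · exact (h _ _).pow
    · exact (h _ _).pow_left
    · exact (h _ _).pow
    · exact (h _ _).pow_left
  have h2 : IsUnit (evalDiagonal n p) := h1 (map_dvd _ hp1) (map_dvd _ hp2)
  -- Each variable is sent to a variable or to `0`, so constant terms are preserved.
  have h3 : (constantCoeff : _ →+* ℤ) (evalDiagonal n p) = constantCoeff p := by
    suffices h : (constantCoeff : _ →+* ℤ).comp (evalDiagonal n).toRingHom = constantCoeff from
      congrArg (fun g : _ →+* ℤ => g p) h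
    apply MvPolynomial.ringHom_ext
    · intro r
      simp
    · rintro (⟨i, j⟩ | ⟨i, j⟩) <;> by_cases h : i = j <;>
        simp [evalDiagonal, evalPair, h]
  rw [← h3]
  exact h2.map _

end Generic

/-! ### Adjoining eigenvalues in an integral closure -/

section Integral

variable (R : Type*) [CommRing R] [IsDomain R]

/-- The integral closure of a domain in an algebraic closure of its field of fractions. -/
abbrev AbsoluteIntegralClosure : Type _ :=
  integralClosure R (AlgebraicClosure (FractionRing R))

variable {R}

/-- The quotient `b / a` lies in the fraction field and is integral over `R`, hence belongs to `R`.
-/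
theorem dvd_of_algebraMap_dvd [IsIntegrallyClosed R] {a b : R} (ha : a ≠ 0)
    (h : algebraMap R (AbsoluteIntegralClosure R) a ∣ algebraMap R _ b) : a ∣ b := by
  obtain ⟨c, hc⟩ := h
  set K := FractionRing R
  set F := AlgebraicClosure K
  have ha' : algebraMap R K a ≠ 0 := by
    simpa using ha
  have hc' : algebraMap K F (algebraMap R K b) = algebraMap K F (algebraMap R K a) * (c : F) :=
    congrArg Subtype.val hc
  have h1 : (c : F) = algebraMap K F (algebraMap R K b / algebraMap R K a) := by
    rw [map_div₀, hc', mul_div_cancel_left₀]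
    simpa using ha
  have h2 : IsIntegral R (algebraMap R K b / algebraMap R K a) := by
    rw [← isIntegral_algebraMap_iff (B := F) (algebraMap K F).injective, ← h1]
    exact c.2
  obtain ⟨y, hy⟩ := IsIntegrallyClosed.isIntegral_iff.1 h2
  refine ⟨y, IsFractionRing.injective R K ?_⟩
  rw [map_mul, hy, mul_div_cancel₀ _ ha']

theorem exists_roots {n : ℕ} (p : Polynomial R) (hp : p.Monic) (hn : p.natDegree = n) :
    ∃ l : Fin n → AbsoluteIntegralClosure R,
      p.map (algebraMap R (AbsoluteIntegralClosure R)) =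
        ∏ i, (Polynomial.X - Polynomial.C (l i)) := by
  set F := AlgebraicClosure (FractionRing R)
  set P := p.map (algebraMap R F) with hP
  have hPm : P.Monic := hp.map _
  have hsplit : P.Splits := IsAlgClosed.splits P
  have hprod := hsplit.eq_prod_roots_of_monic hPm
  have hcard : P.roots.toList.length = n := by
    rw [Multiset.length_toList, ← hn, ← hp.natDegree_map (algebraMap R F)]
    exact (Polynomial.splits_iff_card_roots.1 hsplit)
  have hint : ∀ x ∈ P.roots.toList, IsIntegral R x := by
    intro x hx
    rw [Multiset.mem_toList, Polynomial.mem_roots hPm.ne_zero] at hx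
    refine ⟨p, hp, ?_⟩
    rwa [Polynomial.IsRoot, hP, Polynomial.eval_map] at hx
  refine ⟨fun i => ⟨P.roots.toList.get (i.cast hcard.symm), hint _ (List.get_mem _ _)⟩, ?_⟩
  apply Polynomial.map_injective (algebraMap (AbsoluteIntegralClosure R) F)
    Subtype.val_injective
  rw [Polynomial.map_map, ← IsScalarTower.algebraMap_eq, Polynomial.map_prod]
  change P = _
  conv_lhs => rw [hprod, ← Multiset.coe_toList P.roots, Multiset.map_coe, Multiset.prod_coe]
  rw [← Equiv.prod_comp (finCongr hcard)]
  simp only [Polynomial.map_sub, Polynomial.map_X, Polynomial.map_C]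
  conv_lhs => rw [← List.ofFn_get P.roots.toList]
  rw [List.map_ofFn, List.prod_ofFn]
  rfl

end Integral

/-! ### Divisibility of the triangulant by `G_k(A) * G_k(B)` -/

section Divisibility

theorem gPoly_dvd_triangulant (n k : ℕ) :
    rename Sum.inl (gPoly n k) * rename Sum.inr (gPoly n k) ∣
      triangulant (powMatrix k (genericA n)) (powMatrix k (genericB n)) := by
  set R := MvPolynomial ((Fin n × Fin n) ⊕ (Fin n × Fin n)) ℤ with hR
  set f : R →+* AbsoluteIntegralClosure R := algebraMap R (AbsoluteIntegralClosure R) with hf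
  obtain ⟨l, hl⟩ := exists_roots (genericA n).charpoly (Matrix.charpoly_monic _)
    ((Matrix.charpoly_natDegree_eq_dim _).trans (Fintype.card_fin n))
  obtain ⟨m, hm⟩ := exists_roots (genericB n).charpoly (Matrix.charpoly_monic _)
    ((Matrix.charpoly_natDegree_eq_dim _).trans (Fintype.card_fin n))
  rw [← Matrix.charpoly_map] at hl hm
  set A := (genericA n).map f with hA
  set B := (genericB n).map f with hB
  obtain ⟨W, hW, hWd⟩ := exists_intertwine A l hl
  obtain ⟨V, hV, hVd⟩ := exists_intertwine B.transpose m
    ((Matrix.charpoly_transpose B).trans hm)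
  have hQ : B * V.transpose = V.transpose * Matrix.diagonal m := by
    have := congrArg Matrix.transpose hV
    simpa [Matrix.transpose_mul] using this
  set s := k * Fintype.card (Set.powersetCard (Fin n) k) with hs
  set N := n.choose k
  have key := triangulant_powMatrix_of_intertwine k l m hW hQ
  have hWk : (compound k W).det ∣ f (clearingFactor n) ^ s := by
    refine (det_compound_dvd k W).trans (pow_dvd_pow_of_dvd ?_ _)
    rw [← evalPair_generic (clearingFactor n) (f := f), evalPair_clearingFactor hl hm]
    exact hWd.mul_right _
  have hQk : (compound k V.transpose).det ∣ f (clearingFactor n) ^ s := by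
    refine (det_compound_dvd k _).trans (pow_dvd_pow_of_dvd ?_ _)
    rw [← evalPair_generic (clearingFactor n) (f := f), evalPair_clearingFactor hl hm,
      Matrix.det_transpose]
    exact hVd.mul_left _
  have hG : f (rename Sum.inl (gPoly n k) * rename Sum.inr (gPoly n k)) =
      higherDeltaVal n k l ^ N * higherDeltaVal n k m ^ N := by
    rw [← evalPair_generic _ (f := f), map_mul, evalPair_rename_inl, evalPair_rename_inr,
      aeval_gPoly k _ l hl, aeval_gPoly k _ m hm]
  have hT : f (triangulant (powMatrix k (genericA n)) (powMatrix k (genericB n))) =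
      triangulant (powMatrix k A) (powMatrix k B) := by
    rw [← evalPair_generic _ (f := f), evalPair_triangulant]
  -- The determinants of the compounds of `W` and `Vᵀ` are replaced by powers of `clearingFactor`,
  -- so that both sides come from the polynomial ring and the divisibility can descend.
  have h1 : f (rename Sum.inl (gPoly n k) * rename Sum.inr (gPoly n k)) ∣
      f (((clearingFactor n ^ s) ^ N * (clearingFactor n ^ s) ^ N) *
        triangulant (powMatrix k (genericA n)) (powMatrix k (genericB n))) := by
    rw [hG, map_mul, hT, map_mul, map_pow, map_pow]
    refine Dvd.dvd.trans ?_ (key.symm.dvd.trans ?_)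
    · refine Dvd.dvd.mul_right (mul_dvd_mul (pow_dvd_pow_of_dvd ?_ _) (pow_dvd_pow_of_dvd ?_ _)) _
      · exact dvd_mul_left _ _
      · exact dvd_mul_left _ _
    · rw [mul_right_comm]
      exact mul_dvd_mul (mul_dvd_mul (pow_dvd_pow_of_dvd hWk _) (pow_dvd_pow_of_dvd hQk _))
        dvd_rfl
  refine IsRelPrime.dvd_of_dvd_mul_left ?_ (dvd_of_algebraMap_dvd (gPoly_mul_ne_zero n k) h1)
  have h2 := isRelPrime_gPoly_clearingFactor n k
  exact IsRelPrime.mul_right h2.pow_right.pow_right h2.pow_right.pow_right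

/-- The default value of `exactQuotient` does not occur. -/
theorem gPoly_mul_kTriangulant (n k : ℕ) :
    (rename Sum.inl (gPoly n k) * rename Sum.inr (gPoly n k)) * kTriangulant n k =
      triangulant (powMatrix k (genericA n)) (powMatrix k (genericB n)) := by
  have h := gPoly_dvd_triangulant n k
  rw [kTriangulant, exactQuotient, dif_pos h]
  exact h.choose_spec.symm

end Divisibility

end Triangulant

/-! ### A family of matrices with a Jordan block -/

namespace Triangulant

open Matrix

section Jordan

variable {R : Type*} [CommRing R] {n : ℕ}

/-- The diagonal matrix of `l` with an additional entry `1` at the place `(i, j)`. -/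
def jordan (i j : Fin n) (l : Fin n → R) : Matrix (Fin n) (Fin n) R :=
  diagonal l + Matrix.single i j 1

/-- A matrix of left eigenvectors of `jordan i j l`. -/
def jordanEigen (i j : Fin n) (l : Fin n → R) : Matrix (Fin n) (Fin n) R :=
  transvection i j (-1) * diagonal (Function.update 1 i (l j - l i))

theorem jordanEigen_mul_apply {i j : Fin n} (hij : i ≠ j) (l : Fin n → R)
    (H : Matrix (Fin n) (Fin n) R) :
    (jordanEigen i j l * H) = H.updateRow i ((l j - l i) • H i + (-1 : R) • H j) := by
  ext x y
  rw [jordanEigen, Matrix.mul_assoc]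
  by_cases hx : x = i
  · subst hx
    rw [transvection_mul_apply_same, updateRow_self, diagonal_mul, diagonal_mul]
    simp [hij.symm]
  · rw [transvection_mul_apply_of_ne _ _ _ _ hx, updateRow_ne hx, diagonal_mul]
    simp [hx]

theorem jordanEigen_mul_jordan {i j : Fin n} (hij : i ≠ j) (l : Fin n → R) :
    jordanEigen i j l * jordan i j l = diagonal l * jordanEigen i j l := by
  have h : jordanEigen i j l = (1 : Matrix (Fin n) (Fin n) R).updateRow i
      ((l j - l i) • (1 : Matrix (Fin n) (Fin n) R) i +
        (-1 : R) • (1 : Matrix (Fin n) (Fin n) R) j) := by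
    rw [← jordanEigen_mul_apply hij, Matrix.mul_one]
  rw [jordanEigen_mul_apply hij, h]
  ext x y
  rw [diagonal_mul]
  by_cases hx : x = i
  · subst hx
    simp only [updateRow_self, jordan, Pi.add_apply, Pi.smul_apply, Matrix.add_apply,
      smul_eq_mul, diagonal_apply, single_apply, one_apply]
    by_cases h1 : x = y
    · subst h1
      simp [hij.symm]
      ring
    · by_cases h2 : j = y
      · subst h2
        simp [hij]
        ring
      · simp [h1, h2]
  · simp only [updateRow_ne hx, jordan, Matrix.add_apply, diagonal_apply, single_apply, one_apply]
    simp [Ne.symm hx]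

theorem charpoly_jordan {i j : Fin n} (hij : i < j) (l : Fin n → R) :
    (jordan i j l).charpoly = ∏ x, (Polynomial.X - Polynomial.C (l x)) := by
  rw [charpoly_of_isUpperTriangular]
  · simp [jordan, single_apply]
    refine Finset.prod_congr rfl fun x _ => ?_
    rw [if_neg, add_zero]
    rintro ⟨rfl, rfl⟩
    exact lt_irrefl _ hij
  · intro x y hxy
    simp only [jordan, Matrix.add_apply, single_apply, id] at hxy ⊢
    rw [diagonal_apply_ne _ hxy.ne', if_neg, add_zero]
    rintro ⟨rfl, rfl⟩
    exact hij.asymm hxy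

theorem associated_det_compound_jordanEigen (k : ℕ) {i j : Fin n} (hij : i ≠ j) (l : Fin n → R) :
    Associated (compound k (jordanEigen i j l)).det
      ((l j - l i) ^ Finset.card {s : Set.powersetCard (Fin n) k | i ∈ (s : Finset (Fin n))}) := by
  rw [jordanEigen, compound_mul, det_mul]
  have h1 : IsUnit (compound k (transvection i j (-1 : R))).det := by
    refine isUnit_of_dvd_one ((det_compound_dvd k _).trans ?_)
    rw [det_transvection_of_ne _ _ hij, one_pow]
  refine (associated_unit_mul_left _ _ h1).trans (.of_eq ?_)
  rw [compound_diagonal, det_diagonal, Finset.card_filter, ← Finset.prod_pow_eq_pow_sum]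
  refine Finset.prod_congr rfl fun s _ => ?_
  have h2 : Function.update (1 : Fin n → R) i (l j - l i) =
      fun x => if x = i then l j - l i else 1 := by
    funext x
    rw [Function.update_apply, Pi.one_apply]
  rw [h2, Finset.prod_ite_eq']
  split_ifs <;> simp

/-- A minor of `jordanEigen i j l * H`, divided by `l j - l i` if it contains the rows
`i` and `j`. -/
noncomputable def reducedMinor {k : ℕ} (i j : Fin n) (l : Fin n → R)
    (H : Matrix (Fin n) (Fin n) R) (s t : Set.powersetCard (Fin n) k) : R :=
  if i ∈ (s : Finset (Fin n)) ∧ j ∈ (s : Finset (Fin n)) then compound k H s t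
  else compound k (jordanEigen i j l * H) s t

/-- Row `i` of the product is `(l j - l i) • H i - H j`. If row `j` is also in the minor, the
summand `-H j` drops out and `l j - l i` factors off. -/
theorem compound_jordanEigen_mul {k : ℕ} {i j : Fin n} (hij : i ≠ j) (l : Fin n → R)
    (H : Matrix (Fin n) (Fin n) R) (s t : Set.powersetCard (Fin n) k) :
    compound k (jordanEigen i j l * H) s t =
      (if i ∈ (s : Finset (Fin n)) ∧ j ∈ (s : Finset (Fin n)) then l j - l i else 1) *
        reducedMinor i j l H s t := by
  rw [reducedMinor]
  split_ifs with h
  · obtain ⟨a, ha⟩ := (mem_range_enum s i).2 h.1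
    obtain ⟨b, hb⟩ := (mem_range_enum s j).2 h.2
    have hab : a ≠ b := fun e => hij (by rw [← ha, ← hb, e])
    set N := H.submatrix (enum s) (enum t) with hN
    have h1 : (jordanEigen i j l * H).submatrix (enum s) (enum t) =
        N.updateRow a ((l j - l i) • N a + (-1 : R) • N b) := by
      rw [jordanEigen_mul_apply hij]
      ext x y
      by_cases hx : x = a
      · subst hx
        simp [hN, ha, hb]
      · have : enum s x ≠ i := fun e => hx (enum_injective s (e.trans ha.symm))
        simp [hN, hx, this]
    rw [compound_apply, compound_apply, h1, det_updateRow_add, det_updateRow_smul,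
      det_updateRow_smul, updateRow_eq_self, det_updateRow_eq_zero hab.symm, mul_zero, add_zero]
  · rw [one_mul]

theorem map_compound {S : Type*} [CommRing S] (f : R →+* S) (k : ℕ)
    (P : Matrix (Fin n) (Fin n) R) (s t : Set.powersetCard (Fin n) k) :
    f (compound k P s t) = compound k (P.map f) s t := by
  rw [compound_apply, compound_apply, RingHom.map_det]
  rfl

theorem map_jordan {S : Type*} [CommRing S] (f : R →+* S) (i j : Fin n) (l : Fin n → R) :
    (jordan i j l).map f = jordan i j (f ∘ l) := by
  ext x y
  simp only [jordan, map_apply, Matrix.add_apply, diagonal_apply, single_apply, map_add]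
  split_ifs <;> simp

theorem map_jordanEigen_mul {S : Type*} [CommRing S] (f : R →+* S) {i j : Fin n} (hij : i ≠ j)
    (l : Fin n → R) (H : Matrix (Fin n) (Fin n) R) :
    (jordanEigen i j l * H).map f = jordanEigen i j (f ∘ l) * H.map f := by
  rw [jordanEigen_mul_apply hij, jordanEigen_mul_apply hij]
  ext x y
  by_cases hx : x = i
  · subst hx; simp
  · simp [hx]

theorem map_reducedMinor {S : Type*} [CommRing S] (f : R →+* S) {i j : Fin n} (hij : i ≠ j)
    (l : Fin n → R) (H : Matrix (Fin n) (Fin n) R) {k : ℕ} (s t : Set.powersetCard (Fin n) k) :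
    f (reducedMinor i j l H s t) = reducedMinor i j (f ∘ l) (H.map f) s t := by
  rw [reducedMinor, reducedMinor]
  split_ifs
  · rw [map_compound]
  · rw [map_compound, map_jordanEigen_mul f hij]

/-- The product `δ_1(l)` without the factor `l j - l i`. -/
def restDelta (i j : Fin n) (l : Fin n → R) : R :=
  ∏ p ∈ ({p : Fin n × Fin n | p.1 < p.2} : Finset _).erase (i, j), (l p.2 - l p.1)

theorem map_restDelta {S : Type*} [CommRing S] (f : R →+* S) (i j : Fin n) (l : Fin n → R) :
    f (restDelta i j l) = restDelta i j (f ∘ l) := by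
  simp [restDelta, map_prod]

theorem deltaVal_one_eq {i j : Fin n} (hij : i < j) (l : Fin n → R) :
    deltaVal n 1 l = (l j - l i) * restDelta i j l := by
  rw [deltaVal_one, restDelta]
  exact (Finset.mul_prod_erase _ (fun p : Fin n × Fin n => l p.2 - l p.1) (a := (i, j))
    (by simpa using hij)).symm

/-- The value of the triangulant at `jordan i j l` and a matrix with eigenvectors `H` and
eigenvalues `m`, up to powers of `det H`. -/
noncomputable def jordanValue (k : ℕ) (i j : Fin n) (l m : Fin n → R)
    (H : Matrix (Fin n) (Fin n) R) : R :=
  (restDelta i j l ^ sepCount n k) ^ n.choose k * (deltaVal n 1 m ^ sepCount n k) ^ n.choose k *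
    ∏ s : Set.powersetCard (Fin n) k, ∏ t, reducedMinor i j l H s t

theorem map_jordanValue {S : Type*} [CommRing S] (f : R →+* S) (k : ℕ) {i j : Fin n} (hij : i ≠ j)
    (l m : Fin n → R) (H : Matrix (Fin n) (Fin n) R) :
    f (jordanValue k i j l m H) = jordanValue k i j (f ∘ l) (f ∘ m) (H.map f) := by
  simp only [jordanValue, map_mul, map_pow, map_restDelta, map_deltaVal, map_prod,
    map_reducedMinor f hij]

/-- The factor `l j - l i` occurs with exponent `c1 * N` in the eigenvector determinant, `c * N` in
the power of `δ_1(l)` and `c2 * N` in the minors. Here `c1`, `c`, `c2` count the `k`-subsets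
containing `i`, those containing `i` but not `j`, and those containing both, so `c1 = c + c2` and
everything cancels. -/
theorem associated_jordanValue [IsDomain R] (k : ℕ) {i j : Fin n} (hij : i < j) {l m : Fin n → R}
    {H : Matrix (Fin n) (Fin n) R} {T : R} (hl : l j - l i ≠ 0) (hl' : higherDeltaVal n k l ≠ 0)
    (hm' : higherDeltaVal n k m ≠ 0)
    (h : Associated ((compound k (jordanEigen i j l)).det ^ n.choose k *
        (higherDeltaVal n k l ^ n.choose k * higherDeltaVal n k m ^ n.choose k * T) *
        (compound k H).det ^ n.choose k)
      ((deltaVal n 1 l ^ sepCount n k * higherDeltaVal n k l) ^ n.choose k *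
        (deltaVal n 1 m ^ sepCount n k * higherDeltaVal n k m) ^ n.choose k *
        ∏ s, ∏ t, compound k (jordanEigen i j l * H) s t)) :
    Associated (T * (compound k H).det ^ n.choose k) (jordanValue k i j l m H) := by
  set N := n.choose k with hN
  set e := l j - l i with he
  set c := sepCount n k with hc
  set c1 := Finset.card {s : Set.powersetCard (Fin n) k | i ∈ (s : Finset (Fin n))} with hc1
  set c2 := Finset.card {s : Set.powersetCard (Fin n) k |
    i ∈ (s : Finset (Fin n)) ∧ j ∈ (s : Finset (Fin n))} with hc2
  have hcc : c1 = c + c2 := by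
    rw [hc1, hc, ← card_sep k hij.ne, hc2, ← Finset.card_union_of_disjoint]
    · congr 1
      ext s
      simp only [Finset.mem_filter, Finset.mem_univ, true_and, Finset.mem_union]
      tauto
    · rw [Finset.disjoint_left]
      intro s
      simp only [Finset.mem_filter, Finset.mem_univ, true_and]
      tauto
  have hprod : ∏ s, ∏ t, compound k (jordanEigen i j l * H) s t =
      (e ^ c2) ^ N * ∏ s : Set.powersetCard (Fin n) k, ∏ t, reducedMinor i j l H s t := by
    simp only [compound_jordanEigen_mul hij.ne, Finset.prod_mul_distrib]
    congr 1
    rw [Finset.prod_comm, Finset.prod_const, Finset.card_univ, card_powersetCard_fin,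
      Finset.prod_ite, Finset.prod_const, Finset.prod_const_one, mul_one]
  have hZ : (e ^ c1) ^ N * (higherDeltaVal n k l ^ N * higherDeltaVal n k m ^ N) ≠ 0 :=
    mul_ne_zero (pow_ne_zero _ (pow_ne_zero _ hl)) (mul_ne_zero (pow_ne_zero _ hl')
      (pow_ne_zero _ hm'))
  refine Associated.of_mul_left ?_ (Associated.refl _) hZ
  have h1 : Associated ((e ^ c1) ^ N * (higherDeltaVal n k l ^ N * higherDeltaVal n k m ^ N) *
      (T * (compound k H).det ^ N)) ((compound k (jordanEigen i j l)).det ^ N *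
        (higherDeltaVal n k l ^ N * higherDeltaVal n k m ^ N * T) * (compound k H).det ^ N) := by
    have h2 := ((associated_det_compound_jordanEigen k hij.ne l).pow_pow (n := N)).symm.mul_right
      ((higherDeltaVal n k l ^ N * higherDeltaVal n k m ^ N * T) * (compound k H).det ^ N)
    refine (Associated.of_eq ?_).trans (h2.trans (.of_eq ?_))
    · ring
    · ring
  refine h1.trans (h.trans (.of_eq ?_))
  rw [hprod, jordanValue, deltaVal_one_eq hij, ← he, hcc]
  simp only [mul_pow, pow_add]
  ring

end Jordan

end Triangulant

/-! ### The discriminants do not divide the triangulant -/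

namespace Triangulant

open MvPolynomial

section Specialize

variable {n : ℕ}

theorem charpoly_of_intertwine {R : Type*} [CommRing R] [IsDomain R]
    {B H D : Matrix (Fin n) (Fin n) R} (h : B * H = H * D) (hH : H.det ≠ 0) :
    B.charpoly = D.charpoly := by
  have h1 : B.charmatrix * Polynomial.C.mapMatrix H = Polynomial.C.mapMatrix H * D.charmatrix := by
    rw [Matrix.charmatrix, Matrix.charmatrix, Matrix.sub_mul, Matrix.mul_sub, ← map_mul, h, map_mul]
    congr 1
    exact Matrix.scalar_comm _ (fun _ => Commute.all _ _) _
  have h2 := congrArg Matrix.det h1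
  rw [Matrix.det_mul, Matrix.det_mul, mul_comm] at h2
  refine mul_left_cancel₀ ?_ h2
  rw [← RingHom.map_det]
  simpa using hH

/-- The matrix `H diag(m) adj(H)`. -/
def conjDiagonal {R : Type*} [CommRing R] (m : Fin n → R) (H : Matrix (Fin n) (Fin n) R) :
    Matrix (Fin n) (Fin n) R :=
  H * Matrix.diagonal m * H.adjugate

/-- Using the adjugate instead of the inverse keeps the matrix polynomial; the eigenvalues are
merely scaled by `H.det`. -/
theorem conjDiagonal_mul {R : Type*} [CommRing R] (m : Fin n → R)
    (H : Matrix (Fin n) (Fin n) R) :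
    conjDiagonal m H * H = H * Matrix.diagonal (fun i => H.det * m i) := by
  rw [conjDiagonal, Matrix.mul_assoc, Matrix.adjugate_mul, Matrix.mul_assoc, Matrix.mul_smul,
    Matrix.mul_one, ← Matrix.diagonal_smul]
  rfl

section

variable {S : Type*} [CommRing S] [IsDomain S] [Algebra ℤ S]

/-- The value of the triangulant at a matrix with a Jordan block and a diagonalizable matrix. -/
theorem evalPair_kTriangulant_jordan (k : ℕ) {i j : Fin n} (hij : i < j)
    {l m : Fin n → S} {B H : Matrix (Fin n) (Fin n) S} (hB : B * H = H * Matrix.diagonal m)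
    (hl : l j - l i ≠ 0) (hl' : higherDeltaVal n k l ≠ 0)
    (hm' : higherDeltaVal n k m ≠ 0) (hH : H.det ≠ 0) :
    Associated (evalPair ℤ (jordan i j l) B (kTriangulant n k) *
      (compound k H).det ^ n.choose k) (jordanValue k i j l m H) := by
  have hc : B.charpoly = ∏ x, (Polynomial.X - Polynomial.C (m x)) :=
    (charpoly_of_intertwine hB hH).trans (charpoly_diagonal _)
  have h1 := congrArg (evalPair ℤ (jordan i j l) B) (gPoly_mul_kTriangulant n k)
  rw [map_mul, map_mul, evalPair_rename_inl, evalPair_rename_inr,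
    aeval_gPoly k _ l (charpoly_jordan hij l), aeval_gPoly k _ m hc, evalPair_triangulant] at h1
  refine associated_jordanValue k hij hl hl' hm' ?_
  rw [h1]
  exact triangulant_powMatrix_of_intertwine k l m (jordanEigen_mul_jordan hij.ne l) hB

/-- The same value with the roles of the two matrices exchanged. -/
theorem evalPair_kTriangulant_jordan_transpose (k : ℕ) {i j : Fin n} (hij : i < j)
    {l m : Fin n → S} {B H : Matrix (Fin n) (Fin n) S} (hB : B * H = H * Matrix.diagonal m)
    (hl : l j - l i ≠ 0) (hl' : higherDeltaVal n k l ≠ 0)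
    (hm' : higherDeltaVal n k m ≠ 0) (hH : H.det ≠ 0) :
    Associated (evalPair ℤ B.transpose (jordan i j l).transpose (kTriangulant n k) *
      (compound k H).det ^ n.choose k) (jordanValue k i j l m H) := by
  have hc : B.transpose.charpoly = ∏ x, (Polynomial.X - Polynomial.C (m x)) :=
    (Matrix.charpoly_transpose B).trans
      ((charpoly_of_intertwine hB hH).trans (charpoly_diagonal _))
  have hc' : (jordan i j l).transpose.charpoly = ∏ x, (Polynomial.X - Polynomial.C (l x)) :=
    (Matrix.charpoly_transpose _).trans (charpoly_jordan hij l)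
  have h1 := congrArg (evalPair ℤ B.transpose (jordan i j l).transpose)
    (gPoly_mul_kTriangulant n k)
  rw [map_mul, map_mul, evalPair_rename_inl, evalPair_rename_inr,
    aeval_gPoly k _ m hc, aeval_gPoly k _ l hc', evalPair_triangulant] at h1
  have hW : H.transpose * B.transpose = Matrix.diagonal m * H.transpose := by
    have := congrArg Matrix.transpose hB
    simpa [Matrix.transpose_mul] using this
  have hQ : (jordan i j l).transpose * (jordanEigen i j l).transpose =
      (jordanEigen i j l).transpose * Matrix.diagonal l := by
    have := congrArg Matrix.transpose (jordanEigen_mul_jordan hij.ne l)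
    simpa [Matrix.transpose_mul] using this
  -- Transposition exchanges left and right eigenvectors. The product of the eigenvector matrices is
  -- now the transpose of `jordanEigen i j l * H`, so the same minors occur.
  have key := triangulant_powMatrix_of_intertwine k m l hW hQ
  rw [← Matrix.transpose_mul, compound_transpose, compound_transpose, compound_transpose,
    Matrix.det_transpose, Matrix.det_transpose, ← h1] at key
  simp only [Matrix.transpose_apply] at key
  rw [Finset.prod_comm] at key
  refine associated_jordanValue k hij hl hl' hm' ?_
  refine (Associated.of_eq ?_).trans (key.trans (.of_eq ?_))
  · ring
  · ring

end

/-- No condition on `l` is needed: if `i` but not `j` belongs to `s`, row `i` still contains `-H j`,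
even when `l j = l i`. -/
theorem reducedMinor_ne_zero {K τ : Type*} [Field K] (k : ℕ) {i j : Fin n} (hij : i ≠ j)
    (l : Fin n → MvPolynomial τ K) (f : Fin n × Fin n ↪ τ) (s t : Set.powersetCard (Fin n) k) :
    reducedMinor i j l (Matrix.of fun x y => (X (f (x, y)) : MvPolynomial τ K)) s t ≠ 0 := by
  classical
  intro h
  -- `g` selects the rows of `H` that carry the minor, with `j` replacing `i` when `j ∉ s`. The
  -- specialization `H₀` is a partial permutation matrix that makes the minor diagonal with entries
  -- `1` or `-1`.
  set g : Fin k → Fin n := fun a =>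
    if enum s a = i ∧ j ∉ (s : Finset (Fin n)) then j else enum s a with hg
  have hginj : Function.Injective g := by
    intro a b hab
    simp only [hg] at hab
    split_ifs at hab with h1 h2 h2
    · exact enum_injective s (h1.1.trans h2.1.symm)
    · exact absurd (hab ▸ enum_mem s b) h1.2
    · exact absurd (hab ▸ enum_mem s a) h2.2
    · exact enum_injective s hab
  set H₀ : Matrix (Fin n) (Fin n) K := Matrix.of fun x y =>
    if ∃ a, g a = x ∧ enum t a = y then 1 else 0 with hH₀
  have hrow : ∀ a b, H₀ (g a) (enum t b) = if a = b then 1 else 0 := by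
    intro a b
    simp only [hH₀, Matrix.of_apply]
    congr 1
    simp only [eq_iff_iff]
    constructor
    · rintro ⟨c, hc1, hc2⟩
      rw [← hginj hc1, ← enum_injective t hc2]
    · rintro rfl
      exact ⟨a, rfl, rfl⟩
  obtain ⟨φ, hφ⟩ : ∃ φ : MvPolynomial τ K →+* K, ∀ x y, φ (X (f (x, y))) = H₀ x y := by
    refine ⟨eval fun z => if hz : ∃ p, f p = z then H₀ hz.choose.1 hz.choose.2 else 0, ?_⟩
    intro x y
    have hz : ∃ p, f p = f (x, y) := ⟨_, rfl⟩
    rw [eval_X, dif_pos hz, f.injective hz.choose_spec]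
  have h1 := congrArg φ h
  rw [map_reducedMinor φ hij, map_zero] at h1
  have h2 : (Matrix.of fun x y => (X (f (x, y)) : MvPolynomial τ K)).map φ = H₀ := by
    ext x y
    simp [hφ]
  rw [h2, reducedMinor] at h1
  split_ifs at h1 with h3
  · rw [compound_apply] at h1
    have : H₀.submatrix (enum s) (enum t) = 1 := by
      ext a b
      have : g a = enum s a := by simp [hg, h3.2]
      rw [Matrix.submatrix_apply, ← this, hrow, Matrix.one_apply]
    rw [this, Matrix.det_one] at h1
    exact one_ne_zero h1
  · rw [compound_apply, jordanEigen_mul_apply hij] at h1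
    have : (H₀.updateRow i ((φ (l j) - φ (l i)) • H₀ i + (-1 : K) • H₀ j)).submatrix
        (enum s) (enum t) = Matrix.diagonal fun a => if enum s a = i then -1 else 1 := by
      ext a b
      rw [Matrix.submatrix_apply, Matrix.diagonal_apply]
      by_cases ha : enum s a = i
      · have hj : j ∉ (s : Finset (Fin n)) := fun hj => h3 ⟨ha ▸ enum_mem s a, hj⟩
        have hga : g a = j := by simp [hg, ha, hj]
        have hi : ∀ b, g b ≠ i := by
          intro b hb
          simp only [hg] at hb
          split_ifs at hb with h4
          · exact hij hb.symm
          · exact h4 ⟨hb, hj⟩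
        have hHi : H₀ i (enum t b) = 0 := by
          simp only [hH₀, Matrix.of_apply]
          rw [if_neg]
          rintro ⟨c, hc, -⟩
          exact hi c hc
        rw [ha, Matrix.updateRow_self, Pi.add_apply, Pi.smul_apply, Pi.smul_apply, hHi, ← hga,
          hrow]
        simp
      · have hga : g a = enum s a := by simp [hg, ha]
        rw [Matrix.updateRow_ne ha, if_neg ha, ← hga, hrow]
    simp only [Function.comp_apply] at h1
    rw [this, Matrix.det_diagonal, Finset.prod_eq_zero_iff] at h1
    obtain ⟨a, -, ha⟩ := h1
    split_ifs at ha <;> simp at ha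

theorem jordanValue_ne_zero {K τ : Type*} [Field K] (k : ℕ) {i j : Fin n} (hij : i < j)
    {l m : Fin n → MvPolynomial τ K} (f : Fin n × Fin n ↪ τ) (hl : restDelta i j l ≠ 0)
    (hm : deltaVal n 1 m ≠ 0) :
    jordanValue k i j l m (Matrix.of fun x y => (X (f (x, y)) : MvPolynomial τ K)) ≠ 0 := by
  refine mul_ne_zero (mul_ne_zero (pow_ne_zero _ (pow_ne_zero _ hl))
    (pow_ne_zero _ (pow_ne_zero _ hm))) ?_
  exact Finset.prod_ne_zero_iff.2 fun s _ => Finset.prod_ne_zero_iff.2 fun t _ =>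
    reducedMinor_ne_zero k hij.ne l f s t

theorem deltaVal_mul {R : Type*} [CommRing R] (m : ℕ) (c : R) (l : Fin n → R) :
    deltaVal n m (fun i => c * l i) = c ^ (pairs n m).card * deltaVal n m l := by
  rw [deltaVal, deltaVal, ← Finset.prod_const, ← Finset.prod_mul_distrib]
  refine Finset.prod_congr rfl fun p _ => ?_
  rw [← Finset.mul_sum, ← Finset.mul_sum, mul_sub]

theorem det_X_ne_zero {R τ : Type*} [CommRing R] [IsDomain R] (f : Fin n × Fin n ↪ τ) :
    (Matrix.of fun x y => (X (f (x, y)) : MvPolynomial τ R)).det ≠ 0 := by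
  have h := Matrix.det_mvPolynomialX_ne_zero (Fin n) R
  intro h0
  refine h (rename_injective f f.injective ?_)
  rw [map_zero, ← h0]
  have := RingHom.map_det (rename f : MvPolynomial (Fin n × Fin n) R →ₐ[R] _).toRingHom
    (Matrix.mvPolynomialX (Fin n) (Fin n) R)
  refine this.trans ?_
  congr 1
  ext x y
  simp

/-- There are pairwise distinct elements, except for two coinciding ones if `r = 1`, at which
`δ_r` vanishes. -/
theorem exists_deltaVal_eq_zero (K : Type*) [Field K] {r : ℕ} (hr1 : 1 ≤ r) (hrn : r ≤ n / 2)
    {i j : Fin n} (hij : i < j) :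
    ∃ l : Fin n → MvPolynomial (Fin n) K, deltaVal n r l = 0 ∧ restDelta i j l ≠ 0 := by
  classical
  obtain rfl | hr2 : r = 1 ∨ 2 ≤ r := by omega
  · refine ⟨fun x => X (if x = j then i else x), ?_, ?_⟩
    · rw [deltaVal_one_eq hij]
      simp [hij.ne]
    · refine Finset.prod_ne_zero_iff.2 ?_
      rintro ⟨x, y⟩ hp h0
      simp only [Finset.mem_erase, Finset.mem_filter, Finset.mem_univ, true_and, ne_eq,
        Prod.mk.injEq] at hp
      rw [sub_eq_zero] at h0
      have h1 := X_injective h0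
      simp only at h1
      split_ifs at h1 with h2 h3 h3
      · exact hp.2.ne (h3.trans h2.symm)
      · exact hp.1 ⟨h1.symm, h2⟩
      · rw [h3, h1] at hp
        exact hij.asymm hp.2
      · exact hp.2.ne h1.symm
  -- For `S = {0, …, r - 1}` and `T = {r, …, 2r - 1}`, which fit because `2 * r ≤ n`, the equation
  -- `l_S = l_T` is solved for the eigenvalue with index `z`, the last element of `T`.
  · set z : Fin n := ⟨2 * r - 1, by omega⟩ with hz
    set S : Finset (Fin n) := {x | (x : ℕ) < r} with hS
    set T : Finset (Fin n) := {x | r ≤ (x : ℕ) ∧ (x : ℕ) < 2 * r} with hT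
    have hzT : z ∈ T := by
      simp only [hT, hz, Finset.mem_filter, Finset.mem_univ, true_and]
      omega
    have hd : Disjoint S T := by
      rw [Finset.disjoint_left]
      intro x hx hx'
      simp only [hS, hT, Finset.mem_filter, Finset.mem_univ, true_and] at hx hx'
      omega
    have hzS : z ∉ S := fun h => Finset.disjoint_left.1 hd h hzT
    have hScard : S.card = r := by
      rw [hS, ← Finset.card_image_of_injective _ Fin.val_injective]
      conv_rhs => rw [← Finset.card_range r]
      congr 1
      ext x
      simp only [Finset.mem_image, Finset.mem_filter, Finset.mem_univ, true_and, Finset.mem_range]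
      exact ⟨by rintro ⟨y, hy, rfl⟩; exact hy, fun hx => ⟨⟨x, by omega⟩, hx, rfl⟩⟩
    have hTcard : T.card = r := by
      rw [hT, ← Finset.card_image_of_injective _ Fin.val_injective]
      have : (Finset.Ico r (2 * r)).card = r := by rw [Nat.card_Ico]; omega
      conv_rhs => rw [← this]
      congr 1
      ext x
      simp only [Finset.mem_image, Finset.mem_filter, Finset.mem_univ, true_and, Finset.mem_Ico]
      exact ⟨by rintro ⟨y, hy, rfl⟩; exact hy, fun hx => ⟨⟨x, by omega⟩, hx, rfl⟩⟩
    have hmin : S.min < T.min := by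
      have h0 : (⟨0, by omega⟩ : Fin n) ∈ S := by
        simp only [hS, Finset.mem_filter, Finset.mem_univ, true_and]
        omega
      refine lt_of_le_of_lt (Finset.min_le h0) ?_
      obtain ⟨y, hy⟩ := Finset.min_of_mem hzT
      rw [hy, WithTop.coe_lt_coe]
      have := Finset.mem_of_min hy
      simp only [hT, Finset.mem_filter, Finset.mem_univ, true_and] at this
      rw [Fin.lt_def]
      change 0 < (y : ℕ)
      omega
    set w : MvPolynomial (Fin n) K := ∑ s ∈ S, X s - ∑ t ∈ T.erase z, X t with hw
    -- Since `r ≥ 2`, some `y ∈ S` differs from `x`, and `X y` has coefficient `1` in `w`.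
    have hwX : ∀ x, x ≠ z → w ≠ X x := by
      intro x _ hx
      obtain ⟨y, hy, hyx⟩ : ∃ y ∈ S, y ∉ ({x} : Finset (Fin n)) := by
        apply Finset.exists_mem_notMem_of_card_lt_card
        rw [Finset.card_singleton, hScard]
        omega
      have hyT : y ∉ T.erase z := fun h =>
        Finset.disjoint_left.1 hd hy (Finset.mem_of_mem_erase h)
      have := congrArg (eval fun s => if s = y then (1 : K) else 0) hx
      have hxy : x ≠ y := fun e => hyx (by simp [e])
      simp [hw, hy, hyT, hxy, -Finset.mem_erase] at this
    refine ⟨fun x => if x = z then w else X x, ?_, ?_⟩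
    · refine Finset.prod_eq_zero (mem_pairs.2 ⟨hScard, hTcard, hd, hmin⟩ : (S, T) ∈ pairs n r) ?_
      simp only
      rw [← Finset.add_sum_erase _ _ hzT, if_pos rfl,
        Finset.sum_congr rfl fun x hx => if_neg (Finset.ne_of_mem_erase hx),
        Finset.sum_congr (s₁ := S) rfl fun x hx => if_neg (ne_of_mem_of_not_mem hx hzS), hw]
      ring
    · refine Finset.prod_ne_zero_iff.2 ?_
      rintro ⟨x, y⟩ hp h0
      simp only [Finset.mem_erase, Finset.mem_filter, Finset.mem_univ, true_and] at hp
      rw [sub_eq_zero] at h0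
      simp only at h0
      split_ifs at h0 with h2 h3 h3
      · exact hp.2.ne (h3.trans h2.symm)
      · exact hwX x h3 h0
      · exact hwX y h2 h0.symm
      · exact hp.2.ne (X_injective h0).symm

theorem evalPair_map {R K S : Type*} [CommRing R] [CommRing K] [CommRing S] [Algebra ℤ R]
    [Algebra K S] (φ : R →+* S) (A B : Matrix (Fin n) (Fin n) R)
    (p : MvPolynomial ((Fin n × Fin n) ⊕ (Fin n × Fin n)) ℤ) :
    evalPair K (A.map φ) (B.map φ) (map (Int.castRingHom K) p) = φ (evalPair ℤ A B p) := by
  suffices h : ((evalPair K (A.map φ) (B.map φ)).toRingHom.comp (map (Int.castRingHom K))) =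
      φ.comp (evalPair ℤ A B).toRingHom from congrArg (fun g : _ →+* S => g p) h
  apply MvPolynomial.ringHom_ext
  · intro r
    simp
  · rintro (x | x) <;> simp [evalPair]

/-- The variables of the family of matrices with a Jordan block: the eigenvalues of the two
matrices and the entries of a matrix of eigenvectors of the second one. -/
abbrev JordanVar (n : ℕ) : Type := (Fin n ⊕ Fin n) ⊕ (Fin n × Fin n)

/-- The generic matrix of eigenvectors. -/
noncomputable def eigenMatrix (R : Type*) [CommRing R] (n : ℕ) :
    Matrix (Fin n) (Fin n) (MvPolynomial (JordanVar n) R) :=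
  Matrix.of fun x y => X (Function.Embedding.inr (x, y))

/-- The generic eigenvalues of the second matrix. -/
noncomputable def eigenvalue (R : Type*) [CommRing R] (n : ℕ) (i : Fin n) :
    MvPolynomial (JordanVar n) R :=
  X ((Function.Embedding.inr.trans Function.Embedding.inl : Fin n ↪ JordanVar n) i)

/-- The generic eigenvalues of the first matrix. -/
noncomputable def jordanEigenvalue (n : ℕ) (i : Fin n) : MvPolynomial (JordanVar n) ℤ :=
  X ((Function.Embedding.inl.trans Function.Embedding.inl : Fin n ↪ JordanVar n) i)

theorem deltaVal_eigenvalue_ne_zero (R : Type*) [CommRing R] [IsDomain R] (n m : ℕ) :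
    deltaVal n m (fun i => (eigenMatrix R n).det * eigenvalue R n i) ≠ 0 := by
  rw [deltaVal_mul]
  exact mul_ne_zero (pow_ne_zero _ (det_X_ne_zero _)) (deltaVal_X_ne_zero n m _)

variable (K : Type*) [Field K]

/-- Specialization of the eigenvalues of the first matrix. -/
noncomputable def specialize (l : Fin n → MvPolynomial (JordanVar n) K) :
    MvPolynomial (JordanVar n) ℤ →+* MvPolynomial (JordanVar n) K :=
  eval₂Hom (Int.castRingHom _) (Sum.elim (Sum.elim l fun i => X (Sum.inl (Sum.inr i)))
    fun p => X (Sum.inr p))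

theorem specialize_jordanEigenvalue (l : Fin n → MvPolynomial (JordanVar n) K) :
    specialize K l ∘ jordanEigenvalue n = l := by
  funext i
  simp [specialize, jordanEigenvalue]

theorem specialize_eigenMatrix (l : Fin n → MvPolynomial (JordanVar n) K) :
    (eigenMatrix ℤ n).map (specialize K l) = eigenMatrix K n := by
  ext1 x y
  simp [specialize, eigenMatrix]

theorem specialize_eigenvalue (l : Fin n → MvPolynomial (JordanVar n) K) :
    (specialize K l ∘ fun i => (eigenMatrix ℤ n).det * eigenvalue ℤ n i) =
      fun i => (eigenMatrix K n).det * eigenvalue K n i := by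
  funext i
  rw [Function.comp_apply, map_mul, RingHom.map_det, RingHom.mapMatrix_apply,
    specialize_eigenMatrix]
  congr 1
  simp [specialize, eigenvalue]

/-- The association `ht` lives over `ℤ` with generic eigenvalues, where the cancellations are
legitimate. It survives specialization, although the cancelled factors may become zero. -/
theorem kTriangulant_specialize_ne_zero (k : ℕ) {i j : Fin n} (hij : i < j)
    {l : Fin n → MvPolynomial (JordanVar n) K} (hl : restDelta i j l ≠ 0)
    {t : MvPolynomial (JordanVar n) ℤ}
    (ht : Associated (t * (compound k (eigenMatrix ℤ n)).det ^ n.choose k)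
      (jordanValue k i j (jordanEigenvalue n)
        (fun i => (eigenMatrix ℤ n).det * eigenvalue ℤ n i) (eigenMatrix ℤ n))) :
    specialize K l t ≠ 0 := by
  intro h
  have h1 := ht.map (specialize K l)
  rw [map_mul, h, zero_mul, map_jordanValue _ _ hij.ne, specialize_jordanEigenvalue,
    specialize_eigenvalue, specialize_eigenMatrix] at h1
  refine jordanValue_ne_zero k hij _ hl (deltaVal_eigenvalue_ne_zero K n 1)
    (h1.symm.eq_zero_iff.2 rfl)

end Specialize

/-! ### Evaluation at the Jordan family -/

section Main

variable {n : ℕ}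

theorem jordanEigenvalue_sub_ne_zero {i j : Fin n} (hij : i < j) :
    jordanEigenvalue n j - jordanEigenvalue n i ≠ 0 := by
  rw [sub_ne_zero]
  intro h
  exact hij.ne' (Function.Embedding.injective _ (X_injective h))

theorem higherDeltaVal_eigenvalue_ne_zero (n k : ℕ) :
    higherDeltaVal n k (fun i => (eigenMatrix ℤ n).det * eigenvalue ℤ n i) ≠ 0 :=
  Finset.prod_ne_zero_iff.2 fun m _ => pow_ne_zero _ (deltaVal_eigenvalue_ne_zero ℤ n m)

theorem exists_specialization (K : Type*) [Field K] {r : ℕ} (hr1 : 1 ≤ r) (hrn : r ≤ n / 2) :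
    ∃ (i j : Fin n) (l : Fin n → MvPolynomial (JordanVar n) K), i < j ∧
      deltaVal n r l = 0 ∧ restDelta i j l ≠ 0 := by
  have hij : (⟨0, by omega⟩ : Fin n) < ⟨1, by omega⟩ := by simp
  obtain ⟨l, h1, h2⟩ := exists_deltaVal_eq_zero K hr1 hrn hij
  set ι : MvPolynomial (Fin n) K →ₐ[K] MvPolynomial (JordanVar n) K :=
    rename (Function.Embedding.inl.trans Function.Embedding.inl : Fin n ↪ JordanVar n)
  have hι : Function.Injective ι := rename_injective _ (Function.Embedding.injective _)
  refine ⟨_, _, ι ∘ l, hij, ?_, ?_⟩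
  · rw [← map_zero ι, ← h1]
    exact (map_deltaVal ι.toRingHom r l).symm
  · have h3 := map_restDelta ι.toRingHom ⟨0, by omega⟩ ⟨1, by omega⟩ l
    intro h4
    exact h2 (hι ((h3.trans h4).trans (map_zero ι).symm))

theorem disc_inl_not_dvd (K : Type*) [Field K] (n k r : ℕ) (hr1 : 1 ≤ r) (hrn : r ≤ n / 2) :
    ¬ rename (Sum.inl : Fin n × Fin n → (Fin n × Fin n) ⊕ (Fin n × Fin n)) (disc K n r) ∣
        map (Int.castRingHom K) (kTriangulant n k) := by
  obtain ⟨i, j, l, hij, h1, h2⟩ := exists_specialization (n := n) K hr1 hrn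
  intro hdvd
  set B := conjDiagonal (eigenvalue ℤ n) (eigenMatrix ℤ n)
  have hne := kTriangulant_specialize_ne_zero K k hij h2
    (evalPair_kTriangulant_jordan k hij (conjDiagonal_mul (eigenvalue ℤ n) (eigenMatrix ℤ n))
      (jordanEigenvalue_sub_ne_zero hij) (higherDeltaVal_X_ne_zero n k _)
      (higherDeltaVal_eigenvalue_ne_zero n k) (det_X_ne_zero _))
  rw [← evalPair_map (K := K), map_jordan, specialize_jordanEigenvalue] at hne
  have h3 := map_dvd (evalPair K (jordan i j l) (B.map (specialize K l))) hdvd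
  -- The discriminant sees only the characteristic polynomial, so the entry `1` at `(i, j)` does not
  -- prevent it from vanishing.
  rw [evalPair_rename_inl, aeval_disc_eq_zero _ l (charpoly_jordan hij l) h1, zero_dvd_iff] at h3
  exact hne h3

theorem disc_inr_not_dvd (K : Type*) [Field K] (n k r : ℕ) (hr1 : 1 ≤ r) (hrn : r ≤ n / 2) :
    ¬ rename (Sum.inr : Fin n × Fin n → (Fin n × Fin n) ⊕ (Fin n × Fin n)) (disc K n r) ∣
        map (Int.castRingHom K) (kTriangulant n k) := by
  obtain ⟨i, j, l, hij, h1, h2⟩ := exists_specialization (n := n) K hr1 hrn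
  intro hdvd
  set B := conjDiagonal (eigenvalue ℤ n) (eigenMatrix ℤ n)
  have hne := kTriangulant_specialize_ne_zero K k hij h2
    (evalPair_kTriangulant_jordan_transpose k hij
      (conjDiagonal_mul (eigenvalue ℤ n) (eigenMatrix ℤ n))
      (jordanEigenvalue_sub_ne_zero hij) (higherDeltaVal_X_ne_zero n k _)
      (higherDeltaVal_eigenvalue_ne_zero n k) (det_X_ne_zero _))
  rw [← evalPair_map (K := K), Matrix.transpose_map (M := jordan _ _ _), map_jordan,
    specialize_jordanEigenvalue] at hne
  have h3 := map_dvd (evalPair K (B.transpose.map (specialize K l)) (jordan i j l).transpose) hdvd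
  rw [evalPair_rename_inr, aeval_disc_eq_zero _ l
    ((Matrix.charpoly_transpose _).trans (charpoly_jordan hij l)) h1, zero_dvd_iff] at h3
  exact hne h3

end Main

end Triangulant

theorem mainTheorem11 (K : Type*) [Field K] (n k r : ℕ) (hk : k ≤ n)
    (hr1 : 1 ≤ r) (hrn : r ≤ n / 2) :
    ¬ MvPolynomial.rename (Sum.inl : Fin n × Fin n → (Fin n × Fin n) ⊕ (Fin n × Fin n))
          (Triangulant.disc K n r) ∣
        MvPolynomial.map (Int.castRingHom K) (Triangulant.kTriangulant n k) ∧
    ¬ MvPolynomial.rename (Sum.inr : Fin n × Fin n → (Fin n × Fin n) ⊕ (Fin n × Fin n))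
          (Triangulant.disc K n r) ∣
        MvPolynomial.map (Int.castRingHom K) (Triangulant.kTriangulant n k) :=
  ⟨Triangulant.disc_inl_not_dvd K n k r hr1 hrn, Triangulant.disc_inr_not_dvd K n k r hr1 hrn⟩
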